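/- There are an algorithm and a constant $C$ such that, for every finite simple undirected graph $G=(V_G,E_G)$ (with $V_G=\{0,\dots,n-1\}$, given by $n$, $|E_G|$ and a list of its edges in arbitrary order), the algorithm halts after at most $C\,(|V_G|^2\cdot|E_G|+1)$ steps, decides correctly whether $G$ is the square of a graph $H$ of girth at least seven, and, if it is, outputs the list of edges of such a graph $H$. Here the square $H^2$ of $H$ is the graph on the vertex set of $H$ in which two vertices are adjacent if and only if their distance in $H$ is $1$ or $2$; the girth is the length of a shortest cycle, and $\infty$ if there is no cycle. Time is measured on a word RAM whose memory words have $O(\log (n+2))$ bits, with unit cost for each memory access, arithmetic operation (addition, truncated subtraction, multiplication) and comparison. -/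

import Mathlib

/-- The `k`-th power of a graph `H`: two vertices are adjacent iff their distance `d` in `H`
satisfies `1 ≤ d ≤ k` (vertices in different components are at distance `⊤`). -/
def graphPower {V : Type*} (H : SimpleGraph V) (k : ℕ) : SimpleGraph V where
  Adj x y := 1 ≤ H.edist x y ∧ H.edist x y ≤ k
  symm := ⟨fun x y h => by rwa [SimpleGraph.edist_comm]⟩
  loopless := ⟨fun x h => by simp at h⟩

/-- `H` is a square root of `G` of girth at least seven (the girth of a forest is `⊤`). -/
def IsSquareRootGirthSeven {V : Type*} (G H : SimpleGraph V) : Prop :=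
  G = graphPower H 2 ∧ 7 ≤ H.egirth

/-- The list `L` enumerates the edges of `G`, every edge exactly once, in an arbitrary order and
with arbitrary orientations. -/
def IsEdgeList {V : Type*} (G : SimpleGraph V) (L : List (V × V)) : Prop :=
  (L.map fun p => s(p.1, p.2)).Nodup ∧ ∀ e, e ∈ (L.map fun p => s(p.1, p.2)) ↔ e ∈ G.edgeSet

/-- A graph with vertex set `{0, …, n - 1}` as a sequence of numbers: the number of vertices, the
number of edges, and then the two ends of each edge. -/
def encodeGraph (n : ℕ) (L : List (Fin n × Fin n)) : List ℕ :=
  n :: L.length :: L.flatMap fun p => [(p.1 : ℕ), (p.2 : ℕ)]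

namespace WordRAM

/-- The state of the random access machine: registers (a program names finitely many of them) and
a memory that can be addressed indirectly. -/
structure State where
  reg : ℕ → ℕ
  mem : ℕ → ℕ

/-- The arithmetic and comparison operations of the machine. -/
inductive BinOp
  | add
  | sub
  | mul
  | lt
  | eq

/-- Subtraction is truncated at zero; comparisons yield `1` (true) or `0` (false). -/
def BinOp.eval : BinOp → ℕ → ℕ → ℕ
  | .add, a, b => a + b
  | .sub, a, b => a - b
  | .mul, a, b => a * b
  | .lt, a, b => if a < b then 1 else 0
  | .eq, a, b => if a = b then 1 else 0

/-- Expressions: constants, registers, memory cells, and operations. -/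
inductive Expr
  | const (c : ℕ)
  | reg (r : ℕ)
  | load (addr : Expr)
  | op (o : BinOp) (a b : Expr)

/-- The value of an expression. -/
def Expr.eval (s : State) : Expr → ℕ
  | .const c => c
  | .reg r => s.reg r
  | .load addr => s.mem (addr.eval s)
  | .op o a b => o.eval (a.eval s) (b.eval s)

/-- The number of elementary operations performed in evaluating an expression: every constant,
every register access, every memory access and every operation counts one. -/
def Expr.cost : Expr → ℕ
  | .const _ => 1
  | .reg _ => 1
  | .load addr => addr.cost + 1
  | .op _ a b => a.cost + b.cost + 1

/-- Every number that occurs in the evaluation of the expression, addresses included, fits into a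
machine word, that is, is at most `W`. -/
def Expr.Fits (W : ℕ) (s : State) : Expr → Prop
  | .const c => c ≤ W
  | .reg r => s.reg r ≤ W
  | .load addr => addr.Fits W s ∧ s.mem (addr.eval s) ≤ W
  | .op o a b => a.Fits W s ∧ b.Fits W s ∧ o.eval (a.eval s) (b.eval s) ≤ W

/-- Programs. A condition holds if its value is not zero. -/
inductive Program
  | skip
  | assign (r : ℕ) (e : Expr)
  | store (addr e : Expr)
  | seq (p q : Program)
  | cond (b : Expr) (p q : Program)
  | loop (b : Expr) (p : Program)

/-- `Exec W p s t s'`: on a machine whose words hold the numbers `0, …, W`, the program `p`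
started in the state `s` halts in the state `s'` after exactly `t` steps. An overflow leaves the
machine stuck, so that there is no such `t` and `s'`. -/
inductive Exec (W : ℕ) : Program → State → ℕ → State → Prop
  | skip (s : State) : Exec W .skip s 1 s
  | assign (r : ℕ) (e : Expr) (s : State) (he : e.Fits W s) :
      Exec W (.assign r e) s (e.cost + 1) ⟨Function.update s.reg r (e.eval s), s.mem⟩
  | store (addr e : Expr) (s : State) (ha : addr.Fits W s) (he : e.Fits W s) :
      Exec W (.store addr e) s (addr.cost + e.cost + 1)
        ⟨s.reg, Function.update s.mem (addr.eval s) (e.eval s)⟩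
  | seq (p q : Program) (s s' s'' : State) (t t' : ℕ) (hp : Exec W p s t s')
      (hq : Exec W q s' t' s'') : Exec W (.seq p q) s (t + t') s''
  | condTrue (b : Expr) (p q : Program) (s s' : State) (t : ℕ) (hb : b.Fits W s)
      (hv : b.eval s ≠ 0) (hp : Exec W p s t s') : Exec W (.cond b p q) s (b.cost + 1 + t) s'
  | condFalse (b : Expr) (p q : Program) (s s' : State) (t : ℕ) (hb : b.Fits W s)
      (hv : b.eval s = 0) (hq : Exec W q s t s') : Exec W (.cond b p q) s (b.cost + 1 + t) s'
  | loopStop (b : Expr) (p : Program) (s : State) (hb : b.Fits W s) (hv : b.eval s = 0) :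
      Exec W (.loop b p) s (b.cost + 1) s
  | loopStep (b : Expr) (p : Program) (s s' s'' : State) (t t' : ℕ) (hb : b.Fits W s)
      (hv : b.eval s ≠ 0) (hp : Exec W p s t s') (hl : Exec W (.loop b p) s' t' s'') :
      Exec W (.loop b p) s (b.cost + 1 + t + t') s''

/-- The machine is deterministic. -/
theorem Exec.deterministic {W : ℕ} {p : Program} {s s₁ s₂ : State} {t₁ t₂ : ℕ}
    (h₁ : Exec W p s t₁ s₁) (h₂ : Exec W p s t₂ s₂) : t₁ = t₂ ∧ s₁ = s₂ := by
  induction h₁ generalizing t₂ s₂ with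
  | skip s => cases h₂; exact ⟨rfl, rfl⟩
  | assign r e s he => cases h₂; exact ⟨rfl, rfl⟩
  | store addr e s ha he => cases h₂; exact ⟨rfl, rfl⟩
  | seq p q s s' s'' t t' hp hq ihp ihq =>
    cases h₂ with
    | seq _ _ _ _ _ _ _ gp gq =>
      obtain ⟨rfl, rfl⟩ := ihp gp
      obtain ⟨rfl, rfl⟩ := ihq gq
      exact ⟨rfl, rfl⟩
  | condTrue b p q s s' t hb hv hp ih =>
    cases h₂ with
    | condTrue _ _ _ _ _ _ _ _ gp =>
      obtain ⟨rfl, rfl⟩ := ih gp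
      exact ⟨rfl, rfl⟩
    | condFalse _ _ _ _ _ _ _ gv _ => exact absurd gv hv
  | condFalse b p q s s' t hb hv hq ih =>
    cases h₂ with
    | condFalse _ _ _ _ _ _ _ _ gq =>
      obtain ⟨rfl, rfl⟩ := ih gq
      exact ⟨rfl, rfl⟩
    | condTrue _ _ _ _ _ _ _ gv _ => exact absurd hv gv
  | loopStop b p s hb hv =>
    cases h₂ with
    | loopStop _ _ _ _ _ => exact ⟨rfl, rfl⟩
    | loopStep _ _ _ _ _ _ _ _ gv _ _ => exact absurd hv gv
  | loopStep b p s s' s'' t t' hb hv hp hl ihp ihl =>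
    cases h₂ with
    | loopStop _ _ _ _ gv => exact absurd gv hv
    | loopStep _ _ _ _ _ _ _ _ _ gp gl =>
      obtain ⟨rfl, rfl⟩ := ihp gp
      obtain ⟨rfl, rfl⟩ := ihl gl
      exact ⟨rfl, rfl⟩

/-- The initial state on the input `l`: the input is in the memory cells `0, 1, …`, all other cells
and all registers are zero. -/
def initial (l : List ℕ) : State := ⟨fun _ => 0, fun a => l.getD a 0⟩

/-- In the state `s`, the memory cells from the address `base` on hold the sequence `l`. -/
def State.HoldsAt (s : State) (base : ℕ) (l : List ℕ) : Prop :=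
  ∀ i < l.length, s.mem (base + i) = l.getD i 0

end WordRAM

/-! Call an edge of a root `H` internal if both its ends have further neighbours. Those further
neighbours are common `G`-neighbours of the two ends, distinct and nonadjacent in `G`, as there are
no cycles of length 3 to 5. Conversely, if adjacent `a` and `b` were joined only through a middle
vertex `w`, the absence of cycles of length up to 6 would put all their common neighbours into the
closed neighbourhood of `w`, a clique of `G`. So `G` alone determines a set of forced edges that
lies in every root and contains its internal edges (`IsRoot.adj_of_nonadj_common`,
`IsRoot.exists_nonadj_common`).

Each remaining edge has a leaf as an end, and these edges need not be unique. They are added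
greedily to a partial root `F`: a pair `lb` of `G` is added unless an edge of `F` rules it out. If
`F` lies in a root that lacks such an unblocked `lb`, then `l` is a leaf there, its neighbour `p` is
adjacent to `b`, and `p`, `b` are closed twins of `G`; exchanging them gives a root that contains
`F` and `lb` (`IsRoot.exists_attach`). Once all ordered pairs are blocked, a root containing `F`
equals `F` (`IsRoot.eq_of_blocked`). Blocking persists as `F` grows, and an added pair blocks
itself, so each ordered pair is treated only once.

The candidate is then tested by conditions on an edge of `G` and at most two further vertices
(`isRoot_iff`). Every stage is thus a search over pairs of vertices for each edge, whence the time
bound (`WordRAM.Runs.scan`, `WordRAM.Runs.phase`); `WordRAM.run_phases` joins the combinatorics to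
the machine. -/

section SquareRoots

/-! ### Square roots of girth at least seven: forced edges, exchange of twins, verification. -/

variable {V : Type*}

/-- There are no cycles of length at most six, in terms of vertices. -/
structure NoShortCycle (H : SimpleGraph V) : Prop where
  three : ∀ a b c, H.Adj a b → H.Adj b c → H.Adj c a → False
  four : ∀ a b c d, H.Adj a b → H.Adj b c → H.Adj c d → H.Adj d a → a ≠ c → b ≠ d → False
  five : ∀ a b c d e, H.Adj a b → H.Adj b c → H.Adj c d → H.Adj d e → H.Adj e a → False
  six : ∀ a b c d e f, H.Adj a b → H.Adj b c → H.Adj c d → H.Adj d e → H.Adj e f → H.Adj f a →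
    a ≠ c → c ≠ e → a ≠ e → b ≠ d → d ≠ f → b ≠ f → False

/-- The fields ask for few inequalities because the others are automatic: in a closed walk of length
five or six, the remaining coincidences of two vertices would leave a triangle. -/
theorem noShortCycle_iff (H : SimpleGraph V) : NoShortCycle H ↔ 7 ≤ H.egirth := by
  rw [SimpleGraph.le_egirth]
  constructor
  · intro h a w hw
    by_contra hlt
    have hlt : w.length < 7 := by
      rw [not_le] at hlt
      exact_mod_cast hlt
    have h3 := hw.three_le_length
    have hadj : ∀ i, i < w.length → H.Adj (w.getVert i) (w.getVert (i + 1)) :=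
      fun i hi => w.adj_getVert_succ hi
    have hinj : ∀ i j, i ≤ w.length - 1 → j ≤ w.length - 1 → i ≠ j →
        w.getVert i ≠ w.getVert j := fun i j hi hj hij e => hij (hw.getVert_injOn' hi hj e)
    have hlast : w.getVert w.length = w.getVert 0 := by simp
    have hl : w.length = 3 ∨ w.length = 4 ∨ w.length = 5 ∨ w.length = 6 := by omega
    rcases hl with hl | hl | hl | hl <;> rw [hl] at hadj hinj hlast
    · have := hadj 2 (by norm_num)
      rw [hlast] at this
      exact h.three _ _ _ (hadj 0 (by norm_num)) (hadj 1 (by norm_num)) this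
    · have := hadj 3 (by norm_num)
      rw [hlast] at this
      exact h.four _ _ _ _ (hadj 0 (by norm_num)) (hadj 1 (by norm_num)) (hadj 2 (by norm_num)) this
        (hinj _ _ (by norm_num) (by norm_num) (by norm_num))
        (hinj _ _ (by norm_num) (by norm_num) (by norm_num))
    · have := hadj 4 (by norm_num)
      rw [hlast] at this
      exact h.five _ _ _ _ _ (hadj 0 (by norm_num)) (hadj 1 (by norm_num)) (hadj 2 (by norm_num))
        (hadj 3 (by norm_num)) this
    · have := hadj 5 (by norm_num)
      rw [hlast] at this
      exact h.six _ _ _ _ _ _ (hadj 0 (by norm_num)) (hadj 1 (by norm_num)) (hadj 2 (by norm_num))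
        (hadj 3 (by norm_num)) (hadj 4 (by norm_num)) this
        (hinj _ _ (by norm_num) (by norm_num) (by norm_num))
        (hinj _ _ (by norm_num) (by norm_num) (by norm_num))
        (hinj _ _ (by norm_num) (by norm_num) (by norm_num))
        (hinj _ _ (by norm_num) (by norm_num) (by norm_num))
        (hinj _ _ (by norm_num) (by norm_num) (by norm_num))
        (hinj _ _ (by norm_num) (by norm_num) (by norm_num))
  · intro h
    have h3 : ∀ a b c, H.Adj a b → H.Adj b c → H.Adj c a → False := by
      intro a b c hab hbc hca
      have := h a (.cons hab (.cons hbc (.cons hca .nil))) (by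
        have := hab.ne; have := hbc.ne; have := hca.ne
        rw [SimpleGraph.Walk.cons_isCycle_iff]
        simp [*, eq_comm] at *
        exact this)
      norm_num at this
    have h4 : ∀ a b c d, H.Adj a b → H.Adj b c → H.Adj c d → H.Adj d a → a ≠ c → b ≠ d → False := by
      intro a b c d hab hbc hcd hda hac hbd
      have := h a (.cons hab (.cons hbc (.cons hcd (.cons hda .nil)))) (by
        have := hab.ne; have := hbc.ne; have := hcd.ne; have := hda.ne
        rw [SimpleGraph.Walk.cons_isCycle_iff]
        simp [*, eq_comm] at *
        grind)
      norm_num at this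
    refine ⟨h3, h4, ?_, ?_⟩
    · intro a b c d e hab hbc hcd hde hea
      have hac : a ≠ c := by rintro rfl; exact h3 _ _ _ hcd hde hea
      have hbd : b ≠ d := by rintro rfl; exact h3 _ _ _ hde hea hab
      have hce : c ≠ e := by rintro rfl; exact h3 _ _ _ hea hab hbc
      have hda : d ≠ a := by rintro rfl; exact h3 _ _ _ hab hbc hcd
      have heb : e ≠ b := by rintro rfl; exact h3 _ _ _ hbc hcd hde
      have := h a (.cons hab (.cons hbc (.cons hcd (.cons hde (.cons hea .nil))))) (by
        have := hab.ne; have := hbc.ne; have := hcd.ne; have := hde.ne; have := hea.ne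
        rw [SimpleGraph.Walk.cons_isCycle_iff]
        simp [*, eq_comm] at *
        grind)
      norm_num at this
    · intro a b c d e f hab hbc hcd hde hef hfa hac hce hae hbd hdf hbf
      have had : a ≠ d := by rintro rfl; exact h3 _ _ _ hab hbc hcd
      have hbe : b ≠ e := by rintro rfl; exact h3 _ _ _ hbc hcd hde
      have hcf : c ≠ f := by rintro rfl; exact h3 _ _ _ hcd hde hef
      have := h a (.cons hab (.cons hbc (.cons hcd (.cons hde (.cons hef (.cons hfa .nil)))))) (by
        have := hab.ne; have := hbc.ne; have := hcd.ne; have := hde.ne; have := hef.ne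
        have := hfa.ne
        rw [SimpleGraph.Walk.cons_isCycle_iff]
        simp [*, eq_comm] at *
        grind)
      norm_num at this

theorem graphPower_two_adj (H : SimpleGraph V) (x y : V) :
    (graphPower H 2).Adj x y ↔ x ≠ y ∧ (H.Adj x y ∨ ∃ z, H.Adj x z ∧ H.Adj z y) := by
  change 1 ≤ H.edist x y ∧ H.edist x y ≤ (2 : ℕ) ↔ _
  rw [Order.one_le_iff_ne_zero, Ne, SimpleGraph.edist_eq_zero_iff]
  refine and_congr_right fun hxy => ⟨fun h => ?_, ?_⟩
  · obtain ⟨w, hw⟩ := SimpleGraph.exists_walk_of_edist_ne_top (ne_top_of_le_ne_top (by simp) h)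
    rw [← hw] at h
    match w, h with
    | .nil, _ => exact absurd rfl hxy
    | .cons h₁ .nil, _ => exact Or.inl h₁
    | .cons h₁ (.cons h₂ .nil), _ => exact Or.inr ⟨_, h₁, h₂⟩
    | .cons h₁ (.cons h₂ (.cons h₃ p)), h =>
      have : p.length + 1 + 1 + 1 ≤ 2 := by exact_mod_cast h
      omega
  · rintro (h | ⟨z, h₁, h₂⟩)
    · exact (SimpleGraph.edist_le (.cons h .nil)).trans (by simp)
    · exact (SimpleGraph.edist_le (.cons h₁ (.cons h₂ .nil))).trans (by simp)

/-- Square roots of girth at least seven in terms of adjacencies. -/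
structure IsRoot (G H : SimpleGraph V) : Prop where
  adj_iff : ∀ x y, G.Adj x y ↔ x ≠ y ∧ (H.Adj x y ∨ ∃ z, H.Adj x z ∧ H.Adj z y)
  noShortCycle : NoShortCycle H

theorem isSquareRootGirthSeven_iff (G H : SimpleGraph V) :
    IsSquareRootGirthSeven G H ↔ IsRoot G H := by
  rw [IsSquareRootGirthSeven, ← noShortCycle_iff]
  constructor
  · rintro ⟨rfl, h⟩
    exact ⟨graphPower_two_adj H, h⟩
  · rintro ⟨h₁, h₂⟩
    refine ⟨?_, h₂⟩
    ext x y
    rw [h₁, graphPower_two_adj]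

namespace IsRoot

variable {G H : SimpleGraph V} (h : IsRoot G H)

include h

theorem adj_of_adj {x y : V} (hxy : H.Adj x y) : G.Adj x y :=
  (h.adj_iff x y).2 ⟨hxy.ne, Or.inl hxy⟩

theorem adj_of_path {x y z : V} (hxy : H.Adj x y) (hyz : H.Adj y z) (hne : x ≠ z) : G.Adj x z :=
  (h.adj_iff x z).2 ⟨hne, Or.inr ⟨y, hxy, hyz⟩⟩

/-- A coincidence, an edge or a common neighbour of the ends of a path with three edges closes a
cycle of length 3, 4 or 5. -/
theorem not_adj_of_path {a b x y : V} (hab : H.Adj a b) (hax : H.Adj a x) (hxb : x ≠ b)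
    (hby : H.Adj b y) (hya : y ≠ a) : x ≠ y ∧ ¬ G.Adj x y := by
  constructor
  · rintro rfl
    exact h.noShortCycle.three _ _ _ hab hby hax.symm
  · intro hG
    rcases ((h.adj_iff x y).1 hG).2 with hxy | ⟨z, hxz, hzy⟩
    · exact h.noShortCycle.four _ _ _ _ hab hby hxy.symm hax.symm hya.symm hxb.symm
    · exact h.noShortCycle.five _ _ _ _ _ hab hby hzy.symm hxz.symm hax.symm

/-- Together with `u w v`, the connections from `x` to `u` and to `v` close a cycle of length at
most six, unless one of them runs through `w`. The longest case is where girth seven is needed. -/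
theorem adj_middle {u w v x : V} (huw : H.Adj u w) (hwv : H.Adj w v) (huv : u ≠ v)
    (hux : G.Adj u x) (hvx : G.Adj v x) (hxw : x ≠ w) : H.Adj w x := by
  rcases ((h.adj_iff u x).1 hux).2 with h₁ | ⟨a, h₁, h₁'⟩ <;>
    rcases ((h.adj_iff v x).1 hvx).2 with h₂ | ⟨b, h₂, h₂'⟩
  · exact (h.noShortCycle.four _ _ _ _ huw hwv h₂ h₁.symm huv hxw.symm).elim
  · exact (h.noShortCycle.five _ _ _ _ _ huw hwv h₂ h₂' h₁.symm).elim
  · exact (h.noShortCycle.five _ _ _ _ _ huw hwv h₂ h₁'.symm h₁.symm).elim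
  · by_contra hwx
    have hwb : w ≠ b := by rintro rfl; exact hwx h₂'
    have hwa : w ≠ a := by rintro rfl; exact hwx h₁'
    by_cases hab : a = b
    · subst hab
      exact h.noShortCycle.four _ _ _ _ huw hwv h₂ h₁.symm huv hwa
    · exact h.noShortCycle.six _ _ _ _ _ _ huw hwv h₂ h₂' h₁'.symm h₁.symm huv hvx.ne hux.ne hwb
        (Ne.symm hab) hwa

/-- Otherwise `a` and `b` have a middle vertex `w`, and by `adj_middle` both `x` and `y` lie in its
closed neighbourhood, whose square is complete. -/
theorem adj_of_nonadj_common {a b x y : V} (hab : G.Adj a b) (hax : G.Adj a x) (hbx : G.Adj b x)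
    (hay : G.Adj a y) (hby : G.Adj b y) (hxy : x ≠ y) (hG : ¬ G.Adj x y) : H.Adj a b := by
  rcases ((h.adj_iff a b).1 hab).2 with h₁ | ⟨w, h₁, h₂⟩
  · exact h₁
  · exfalso
    have key : ∀ z, G.Adj a z → G.Adj b z → z ≠ w → H.Adj w z := fun z hz hz' =>
      h.adj_middle h₁ h₂ hab.ne hz hz'
    by_cases hxw : x = w
    · subst hxw
      exact hG (h.adj_of_adj (key y hay hby hxy.symm))
    · by_cases hyw : y = w
      · subst hyw
        exact hG (h.adj_of_adj (key x hax hbx hxw).symm)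
      · exact hG (h.adj_of_path (key x hax hbx hxw).symm (key y hay hby hyw) hxy)

/-- An edge of the root both ends of which have another neighbour is recognizable in the square. -/
theorem exists_nonadj_common {a b x y : V} (hab : H.Adj a b) (hax : H.Adj a x) (hxb : x ≠ b)
    (hby : H.Adj b y) (hya : y ≠ a) : ∃ x y, (G.Adj a x ∧ G.Adj b x) ∧ (G.Adj a y ∧ G.Adj b y) ∧
      x ≠ y ∧ ¬ G.Adj x y := by
  obtain ⟨h₁, h₂⟩ := h.not_adj_of_path hab hax hxb hby hya
  exact ⟨x, y, ⟨h.adj_of_adj hax, h.adj_of_path hab.symm hax hxb.symm⟩,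
    ⟨h.adj_of_path hab hby hya.symm, h.adj_of_adj hby⟩, h₁, h₂⟩

/-- Exchanging two closed twins of the square yields another root. -/
theorem comap_swap [DecidableEq V] {p b : V}
    (htw : ∀ z, z ≠ p → z ≠ b → (G.Adj p z ↔ G.Adj b z)) :
    IsRoot G (H.comap (Equiv.swap p b)) := by
  -- The transposition is an automorphism of `G`, and being a root is carried along automorphisms.
  have hG : ∀ x y, G.Adj (Equiv.swap p b x) (Equiv.swap p b y) ↔ G.Adj x y := by
    intro x y
    by_cases hxp : x = p
    · subst hxp
      by_cases hyx : y = x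
      · subst hyx; simp
      · by_cases hyb : y = b
        · subst hyb; simp [G.adj_comm]
        · rw [Equiv.swap_apply_left, Equiv.swap_apply_of_ne_of_ne hyx hyb, htw y hyx hyb]
    · by_cases hxb : x = b
      · subst hxb
        by_cases hyx : y = x
        · subst hyx; simp
        · by_cases hyp : y = p
          · subst hyp; simp [G.adj_comm]
          · rw [Equiv.swap_apply_right, Equiv.swap_apply_of_ne_of_ne hyp hyx, htw y hyp hyx]
      · rw [Equiv.swap_apply_of_ne_of_ne hxp hxb]
        by_cases hyp : y = p
        · subst hyp
          rw [Equiv.swap_apply_left, G.adj_comm, G.adj_comm x, htw x hxp hxb]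
        · by_cases hyb : y = b
          · subst hyb
            rw [Equiv.swap_apply_right, G.adj_comm, G.adj_comm x, htw x hxp hxb]
          · rw [Equiv.swap_apply_of_ne_of_ne hyp hyb]
  have hinj := (Equiv.swap p b).injective
  refine ⟨fun x y => ?_, ?_, ?_, ?_, ?_⟩
  · rw [← hG, h.adj_iff]
    refine and_congr hinj.ne_iff (or_congr Iff.rfl ?_)
    exact (Equiv.swap p b).exists_congr_left.trans (by simp)
  · intro a b c; exact h.noShortCycle.three _ _ _
  · intro a b c d h₁ h₂ h₃ h₄ n₁ n₂
    exact h.noShortCycle.four _ _ _ _ h₁ h₂ h₃ h₄ (hinj.ne n₁) (hinj.ne n₂)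
  · intro a b c d e; exact h.noShortCycle.five _ _ _ _ _
  · intro a b c d e f h₁ h₂ h₃ h₄ h₅ h₆ n₁ n₂ n₃ n₄ n₅ n₆
    exact h.noShortCycle.six _ _ _ _ _ _ h₁ h₂ h₃ h₄ h₅ h₆ (hinj.ne n₁) (hinj.ne n₂) (hinj.ne n₃)
      (hinj.ne n₄) (hinj.ne n₅) (hinj.ne n₆)

end IsRoot

/-- The pair `(x, y)`, as an edge of a partial root, rules out that `l` is to be attached to `b`. -/
def Blocks (G : SimpleGraph V) (l b x y : V) : Prop :=
  x = l ∨ (x = b ∧ ¬ G.Adj l y) ∨ (G.Adj l x ∧ G.Adj l y ∧ x ≠ b ∧ y ≠ b)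

/-- `F` contains the edges that are recognized by two nonadjacent common neighbours of the ends. -/
def ContainsForced (G F : SimpleGraph V) : Prop :=
  ∀ a b, G.Adj a b → (∃ x y, (G.Adj a x ∧ G.Adj b x) ∧ (G.Adj a y ∧ G.Adj b y) ∧
    x ≠ y ∧ ¬ G.Adj x y) → F.Adj a b

/-- If `lb` is not an edge of `H`, there is a path `l p b`. The three ways of blocking are just
strong enough that their failure makes `l` a leaf and leaves `pb` as the only possible edge of `F`
at `p` or `b`; then exchanging `p` and `b` does not disturb `F`. -/
theorem IsRoot.exists_attach {G H F : SimpleGraph V} (h : IsRoot G H) (hFH : F ≤ H)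
    (hF : ContainsForced G F) {l b : V} (hlb : G.Adj l b)
    (hbl : ∀ x y, F.Adj x y → ¬ Blocks G l b x y) :
    ∃ H', IsRoot G H' ∧ F ≤ H' ∧ H'.Adj l b := by
  classical
  rcases ((h.adj_iff l b).1 hlb).2 with h₁ | ⟨p, hlp, hpb⟩
  · exact ⟨H, h, hFH, h₁⟩
  have forced : ∀ {u v x y}, H.Adj u v → H.Adj u x → x ≠ v → H.Adj v y → y ≠ u → F.Adj u v :=
    fun huv hux hxv hvy hyu =>
      hF _ _ (h.adj_of_adj huv) (h.exists_nonadj_common huv hux hxv hvy hyu)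
  have hFl : ∀ y, ¬ F.Adj l y := fun y hy => hbl _ _ hy (Or.inl rfl)
  have hleaf : ∀ z, H.Adj l z → z = p := by
    intro z hz
    by_contra hzp
    exact hFl p (forced hlp hz hzp hpb hlb.ne.symm)
  -- Both ends of such an edge are `G`-adjacent to `l`; if it avoided `b`, it would block in the
  -- third way.
  have hFp : ∀ y, F.Adj p y → y = b := by
    intro y hy
    by_contra hyb
    have hyl : l ≠ y := by rintro rfl; exact hFl _ hy.symm
    exact hbl _ _ hy (Or.inr (Or.inr ⟨h.adj_of_adj hlp, h.adj_of_path hlp (hFH hy) hyl,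
      hpb.ne, hyb⟩))
  -- The second way of blocking would make `y` adjacent to `l` in `G`, but `l p b y` would be a path
  -- with three edges.
  have hFb : ∀ y, F.Adj b y → y = p := by
    intro y hy
    by_contra hyp
    have hly : G.Adj l y := by
      by_contra hly
      exact hbl _ _ hy (Or.inr (Or.inl ⟨rfl, hly⟩))
    exact (h.not_adj_of_path hpb hlp.symm hlb.ne (hFH hy) hyp).2 hly
  -- Were `z` not a leaf, `pz` would be internal, hence forced, against `hFp`.
  have hpleaf : ∀ z w, H.Adj p z → z ≠ b → H.Adj z w → w = p := by
    intro z w hpz hzb hzw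
    by_contra hwp
    exact hzb (hFp z (forced hpz hpb hzb.symm hzw hwp))
  have hbleaf : ∀ z w, H.Adj b z → z ≠ p → H.Adj z w → w = b := by
    intro z w hbz hzp hzw
    by_contra hwb
    exact hzp (hFb z (forced hbz hpb.symm hzp.symm hzw hwb))
  have htw : ∀ z, z ≠ p → z ≠ b → (G.Adj p z ↔ G.Adj b z) := by
    intro z hzp hzb
    constructor <;> intro hz
    · rcases ((h.adj_iff _ _).1 hz).2 with h₁ | ⟨q, h₁, h₂⟩
      · exact h.adj_of_path hpb.symm h₁ hzb.symm
      · by_cases hq : q = b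
        · subst hq; exact h.adj_of_adj h₂
        · exact absurd (hpleaf _ _ h₁ hq h₂) hzp
    · rcases ((h.adj_iff _ _).1 hz).2 with h₁ | ⟨q, h₁, h₂⟩
      · exact h.adj_of_path hpb h₁ hzp.symm
      · by_cases hq : q = p
        · subst hq; exact h.adj_of_adj h₂
        · exact absurd (hbleaf _ _ h₁ hq h₂) hzb
  refine ⟨_, h.comap_swap htw, ?_, ?_⟩
  · intro x y hxy
    change H.Adj (Equiv.swap p b x) (Equiv.swap p b y)
    by_cases hxp : x = p
    · subst hxp
      obtain rfl := hFp _ hxy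
      simpa using hpb.symm
    by_cases hxb : x = b
    · subst hxb
      obtain rfl := hFb _ hxy
      simpa using hpb
    by_cases hyp : y = p
    · subst hyp
      exact absurd (hFp _ hxy.symm) hxb
    by_cases hyb : y = b
    · subst hyb
      exact absurd (hFb _ hxy.symm) hxp
    rw [Equiv.swap_apply_of_ne_of_ne hxp hxb, Equiv.swap_apply_of_ne_of_ne hyp hyb]
    exact hFH hxy
  · change H.Adj (Equiv.swap p b l) (Equiv.swap p b b)
    rw [Equiv.swap_apply_right, Equiv.swap_apply_of_ne_of_ne hlp.ne hlb.ne]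
    exact hlp

/-- Internal edges are forced. For an edge from a leaf `u` to `v`, the pair `(u, v)` can be blocked
consistently with `H` only by the edge `uv` itself. -/
theorem IsRoot.eq_of_blocked {G H F : SimpleGraph V} (h : IsRoot G H) (hFH : F ≤ H)
    (hF : ContainsForced G F)
    (hbl : ∀ l b, G.Adj l b → ∃ x y, F.Adj x y ∧ Blocks G l b x y) : F = H := by
  have hleaf : ∀ u v, H.Adj u v → (∀ z, H.Adj u z → z = v) → F.Adj u v := by
    intro u v huv hu
    obtain ⟨x, y, hxy, rfl | ⟨rfl, hy⟩ | ⟨hx, hy, hxv, hyv⟩⟩ := hbl u v (h.adj_of_adj huv)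
    · obtain rfl := hu y (hFH hxy)
      exact hxy
    · by_cases hyu : u = y
      · subst hyu; exact hxy.symm
      · exact absurd (h.adj_of_path huv (hFH hxy) hyu) hy
    -- All `G`-neighbours of a leaf lie around its neighbour, so a block of the third kind would
    -- form a triangle with `v`.
    · have key : ∀ z, G.Adj u z → z ≠ v → H.Adj v z := by
        intro z hz hzv
        rcases ((h.adj_iff _ _).1 hz).2 with h₁ | ⟨q, h₁, h₂⟩
        · exact absurd (hu z h₁) hzv
        · obtain rfl := hu q h₁
          exact h₂
      exact (h.noShortCycle.three _ _ _ (key x hx hxv) (hFH hxy) (key y hy hyv).symm).elim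
  refine le_antisymm hFH fun u v huv => ?_
  by_cases hu : ∀ z, H.Adj u z → z = v
  · exact hleaf u v huv hu
  by_cases hv : ∀ z, H.Adj v z → z = u
  · exact (hleaf v u huv.symm hv).symm
  push Not at hu hv
  obtain ⟨x, hux, hxv⟩ := hu
  obtain ⟨y, hvy, hyu⟩ := hv
  exact hF _ _ (h.adj_of_adj huv) (h.exists_nonadj_common huv hux hxv hvy hyu)

/-- The local condition that, checked for all edges `ab`, excludes short cycles and edges of the
square that are not in `G`. -/
def Violates (G H : SimpleGraph V) (a b x y : V) : Prop :=
  H.Adj a b ∧ H.Adj a x ∧ x ≠ b ∧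
    ((H.Adj b y ∧ y ≠ a ∧ (x = y ∨ G.Adj x y)) ∨
      (G.Adj x y ∧ G.Adj b y ∧ y ≠ a ∧ ¬ H.Adj a y) ∨ ¬ G.Adj b x)

/-- The alternatives in `Violates` negate `not_adj_of_path`, `adj_middle` and `adj_of_path`. The
first and third together exclude cycles of length 3 to 5, the second then excludes length 6, and the
third keeps the square inside `G`; the last condition is the converse inclusion. -/
theorem isRoot_iff {G H : SimpleGraph V} (hHG : H ≤ G) :
    IsRoot G H ↔ (∀ a b, G.Adj a b → ∀ x y, ¬ Violates G H a b x y) ∧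
      ∀ a b, G.Adj a b → H.Adj a b ∨ ∃ x, H.Adj a x ∧ H.Adj x b := by
  constructor
  · intro h
    refine ⟨?_, fun a b hab => ((h.adj_iff a b).1 hab).2⟩
    rintro a b - x y ⟨hab, hax, hxb, ⟨hby, hya, hxy⟩ | ⟨hxy, hby, hya, hay⟩ | hbx⟩
    · have := h.not_adj_of_path hab hax hxb hby hya
      tauto
    · exact hay (h.adj_middle hax.symm hab hxb hxy hby hya)
    · exact hbx (h.adj_of_path hab.symm hax hxb.symm)
  · rintro ⟨hv, hs⟩
    have hG : ∀ a b, H.Adj a b → ∀ x, H.Adj a x → x ≠ b → G.Adj b x := by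
      intro a b hab x hax hxb
      by_contra hbx
      -- The third alternative does not mention the last vertex, so any value serves.
      exact hv a b (hHG hab) x x ⟨hab, hax, hxb, Or.inr (Or.inr hbx)⟩
    have hN : ∀ a b x y, H.Adj a b → H.Adj a x → x ≠ b → H.Adj b y → y ≠ a →
        x ≠ y ∧ ¬ G.Adj x y := by
      intro a b x y hab hax hxb hby hya
      rw [← not_or]
      exact fun hxy => hv a b (hHG hab) x y ⟨hab, hax, hxb, Or.inl ⟨hby, hya, hxy⟩⟩
    have h3 : ∀ a b c, H.Adj a b → H.Adj b c → H.Adj c a → False := fun a b c hab hbc hca =>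
      (hN a b c c hab hca.symm hbc.ne.symm hbc hca.ne).1 rfl
    have h4 : ∀ a b c d, H.Adj a b → H.Adj b c → H.Adj c d → H.Adj d a → a ≠ c → b ≠ d → False :=
      fun a b c d hab hbc hcd hda hac hbd =>
        (hN a b d c hab hda.symm hbd.symm hbc hac.symm).2 (hHG hcd.symm)
    refine ⟨fun x y => ⟨fun hxy => ⟨hxy.ne, hs x y hxy⟩, ?_⟩, h3, h4, ?_, ?_⟩
    · rintro ⟨hne, h | ⟨z, hxz, hzy⟩⟩
      · exact hHG h
      · exact hG z x hxz.symm y hzy hne.symm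
    · intro a b c d e hab hbc hcd hde hea
      have heb : e ≠ b := by rintro rfl; exact h3 _ _ _ hbc hcd hde
      have hca : c ≠ a := by rintro rfl; exact h3 _ _ _ hcd hde hea
      have hce : c ≠ e := by rintro rfl; exact h3 _ _ _ hea hab hbc
      exact (hN a b e c hab hea.symm heb hbc hca).2 (hG d e hde c hcd.symm hce)
    · intro a b c d e f hab hbc hcd hde hef hfa hac hce hae hbd hdf hbf
      have heb : e ≠ b := by rintro rfl; exact h3 _ _ _ hbc hcd hde
      -- In the hexagon, `e` is `G`-adjacent to both neighbours `a` and `c` of `b`; this forces the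
      -- long chord `be`, which cuts off a 4-cycle.
      have hbe : H.Adj b e := by
        by_contra hbe
        exact hv b a (hHG hab.symm) c e ⟨hab.symm, hbc, hac.symm, Or.inr (Or.inl
          ⟨hG d c hcd.symm e hde hce.symm, hG f a hfa e hef.symm hae.symm, heb, hbe⟩)⟩
      exact h4 _ _ _ _ hbc hcd hde hbe.symm hbd hce

end SquareRoots

namespace WordRAM

/-! ### A program logic with time bounds. -/

section Logic

/-- The state with a new value of a register. -/
def State.setReg (s : State) (r v : ℕ) : State := ⟨Function.update s.reg r v, s.mem⟩

/-- The state with a new value of a memory cell. -/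
def State.setMem (s : State) (a v : ℕ) : State := ⟨s.reg, Function.update s.mem a v⟩

@[simp] theorem State.setReg_reg (s : State) (r v r' : ℕ) :
    (s.setReg r v).reg r' = if r' = r then v else s.reg r' := Function.update_apply ..

@[simp] theorem State.setReg_mem (s : State) (r v : ℕ) : (s.setReg r v).mem = s.mem := rfl

@[simp] theorem State.setMem_reg (s : State) (a v : ℕ) : (s.setMem a v).reg = s.reg := rfl

@[simp] theorem State.setMem_mem (s : State) (a v a' : ℕ) :
    (s.setMem a v).mem a' = if a' = a then v else s.mem a' := Function.update_apply ..

/-- Started in the state `s`, the program `p` halts within `T` steps in a state with the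
property `Q`. -/
def Runs (W : ℕ) (p : Program) (s : State) (T : ℕ) (Q : State → Prop) : Prop :=
  ∃ t s', Exec W p s t s' ∧ t ≤ T ∧ Q s'

variable {W : ℕ} {p q : Program} {s : State} {T T' : ℕ} {Q Q' : State → Prop}

theorem Runs.mono (h : Runs W p s T Q) (hT : T ≤ T') (hQ : ∀ s', Q s' → Q' s') :
    Runs W p s T' Q' := by
  obtain ⟨t, s', he, ht, hs⟩ := h
  exact ⟨t, s', he, ht.trans hT, hQ _ hs⟩

theorem Runs.skip (h : Q s) : Runs W .skip s 1 Q := ⟨1, s, .skip s, le_rfl, h⟩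

theorem Runs.assign {r : ℕ} {e : Expr} (he : e.Fits W s) (h : Q (s.setReg r (e.eval s))) :
    Runs W (.assign r e) s (e.cost + 1) Q := ⟨_, _, .assign r e s he, le_rfl, h⟩

theorem Runs.store {a e : Expr} (ha : a.Fits W s) (he : e.Fits W s)
    (h : Q (s.setMem (a.eval s) (e.eval s))) :
    Runs W (.store a e) s (a.cost + e.cost + 1) Q := ⟨_, _, .store a e s ha he, le_rfl, h⟩

theorem Runs.seq (hp : Runs W p s T Q') (hq : ∀ s', Q' s' → Runs W q s' T' Q) :
    Runs W (.seq p q) s (T + T') Q := by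
  obtain ⟨t, s', he, ht, hs⟩ := hp
  obtain ⟨t', s'', he', ht', hs'⟩ := hq s' hs
  exact ⟨_, _, .seq _ _ _ _ _ _ _ he he', add_le_add ht ht', hs'⟩

theorem Runs.cond {b : Expr} (hb : b.Fits W s) (hp : b.eval s ≠ 0 → Runs W p s T Q)
    (hq : b.eval s = 0 → Runs W q s T Q) : Runs W (.cond b p q) s (b.cost + 1 + T) Q := by
  by_cases hv : b.eval s = 0
  · obtain ⟨t, s', he, ht, hs⟩ := hq hv
    exact ⟨_, _, .condFalse _ _ _ _ _ _ hb hv he, by omega, hs⟩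
  · obtain ⟨t, s', he, ht, hs⟩ := hp hv
    exact ⟨_, _, .condTrue _ _ _ _ _ _ hb hv he, by omega, hs⟩

/-- Register `r` runs from zero to the value of register `rb`. -/
def forLoop (r rb : ℕ) (p : Program) : Program :=
  .seq (.assign r (.const 0)) (.loop (.op .lt (.reg r) (.reg rb))
    (.seq p (.assign r (.op .add (.reg r) (.const 1)))))

/-- Each round pays 4 steps for the test and 4 for the increment; the initialisation (2) and the
failing test (4) make up the constant 6. -/
theorem Runs.forLoop {r rb N : ℕ} (hW : 1 ≤ W) (hN : N ≤ W) (Inv : ℕ → State → Prop)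
    (hInv : ∀ i s, Inv i s → s.reg r = i ∧ s.reg rb = N) (h0 : Inv 0 (s.setReg r 0))
    (hp : ∀ i < N, ∀ s, Inv i s →
      Runs W p s T fun s' => s'.reg r = i ∧ Inv (i + 1) (s'.setReg r (i + 1))) :
    Runs W (forLoop r rb p) s (N * (T + 8) + 6) (Inv N) := by
  have key : ∀ k i s, i + k = N → Inv i s → Runs W (.loop (.op .lt (.reg r) (.reg rb))
      (.seq p (.assign r (.op .add (.reg r) (.const 1))))) s (k * (T + 8) + 4) (Inv N) := by
    intro k
    induction k with
    | zero =>
      intro i s hi hs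
      obtain ⟨h₁, h₂⟩ := hInv i s hs
      obtain rfl : i = N := hi
      exact ⟨_, s, .loopStop _ _ _ (by simp [Expr.Fits, Expr.eval, BinOp.eval, h₁, h₂, hN])
        (by simp [Expr.eval, BinOp.eval, h₁, h₂]), by simp [Expr.cost], hs⟩
    | succ k ih =>
      intro i s hi hs
      obtain ⟨h₁, h₂⟩ := hInv i s hs
      obtain ⟨t, s', he, ht, h₃, h₄⟩ := hp i (by omega) s hs
      have hs' : Exec W (.assign r (.op .add (.reg r) (.const 1))) s' 4 (s'.setReg r (i + 1)) := by
        have := Exec.assign (W := W) r (.op .add (.reg r) (.const 1)) s'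
          (by simp [Expr.Fits, BinOp.eval, Expr.eval, h₃]; omega)
        simpa [Expr.eval, BinOp.eval, h₃, Expr.cost, State.setReg] using this
      obtain ⟨t', s'', he', ht', hQ⟩ := ih (i + 1) _ (by omega) h₄
      refine ⟨_, s'', .loopStep _ _ _ _ _ _ _ ?_ ?_ (.seq _ _ _ _ _ _ _ he hs') he', ?_, hQ⟩
      · simp only [Expr.Fits, Expr.eval, BinOp.eval, h₁, h₂]
        refine ⟨by omega, hN, ?_⟩
        split <;> omega
      · simp only [Expr.eval, BinOp.eval, h₁, h₂]
        rw [if_pos (by omega)]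
        exact one_ne_zero
      · simp only [Expr.cost]
        rw [Nat.succ_mul]
        omega
  refine (Runs.seq (Runs.assign (e := .const 0) (Q := Inv 0) (Nat.zero_le W) h0)
    fun s' hs' => key N 0 s' (Nat.zero_add N) hs').mono ?_ fun _ => id
  simp only [Expr.cost]
  omega

end Logic

/-! ### Matrices in memory, conditions, exhaustive search, and actions. -/

section GraphPrograms

/-- The data of the graph algorithms: two relations as matrices, a flag, and a list of edges. -/
structure Data (n : ℕ) where
  g : Fin n → Fin n → Bool
  h : Fin n → Fin n → Bool
  ok : Bool
  out : List (Fin n × Fin n)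

/-- A list of pairs as a list of numbers. -/
def flatten {n : ℕ} (L : List (Fin n × Fin n)) : List ℕ :=
  L.flatMap fun p => [(p.1 : ℕ), (p.2 : ℕ)]

theorem length_flatten {n : ℕ} (L : List (Fin n × Fin n)) : (flatten L).length = 2 * L.length := by
  induction L with
  | nil => rfl
  | cons p L ih =>
    simp only [flatten, List.flatMap_cons, List.length_append] at ih ⊢
    simp only [ih, List.length_cons, List.length_nil]
    ring

theorem getD_flatten {n : ℕ} (L : List (Fin n × Fin n)) (i : ℕ) (hi : i < L.length) :
    (flatten L).getD (2 * i) 0 = L[i].1 ∧ (flatten L).getD (2 * i + 1) 0 = L[i].2 := by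
  induction L generalizing i with
  | nil => simp at hi
  | cons p L ih =>
    cases i with
    | zero => simp [flatten]
    | succ i => simpa [flatten, Nat.mul_succ] using ih i (by simpa using hi)

/-- The address of the first matrix; the second one and the output are at its multiples. -/
def base (n : ℕ) : ℕ := 2 * n * n + 2

/-- The state `s` holds the edge list `L` and the data `σ`. -/
structure Represents {n : ℕ} (L : List (Fin n × Fin n)) (σ : Data n) (s : State) : Prop where
  reg_ok : s.reg 0 = σ.ok.toNat
  reg_out : s.reg 1 = 3 * base n
  reg_n : s.reg 2 = n
  reg_m : s.reg 3 = L.length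
  reg_count : s.reg 10 = σ.out.length
  reg_base : s.reg 11 = base n
  mem_edge : ∀ i (hi : i < L.length), s.mem (2 + 2 * i) = L[i].1 ∧ s.mem (3 + 2 * i) = L[i].2
  mem_g : ∀ u v : Fin n, s.mem (base n + (n * u + v)) = (σ.g u v).toNat
  mem_h : ∀ u v : Fin n, s.mem (base n + (base n + (n * u + v))) = (σ.h u v).toNat
  mem_out : ∀ k < 2 * σ.out.length, s.mem (3 * base n + 2 + k) = (flatten σ.out).getD k 0

variable {n : ℕ} {L : List (Fin n × Fin n)} {σ : Data n} {s s' : State} {W : ℕ}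

theorem Represents.congr (h : Represents L σ s) (hm : s'.mem = s.mem)
    (hr : ∀ r, r ≤ 3 ∨ r = 10 ∨ r = 11 → s'.reg r = s.reg r) : Represents L σ s' where
  reg_ok := by rw [hr _ (by norm_num), h.reg_ok]
  reg_out := by rw [hr _ (by norm_num), h.reg_out]
  reg_n := by rw [hr _ (by norm_num), h.reg_n]
  reg_m := by rw [hr _ (by norm_num), h.reg_m]
  reg_count := by rw [hr _ (by norm_num), h.reg_count]
  reg_base := by rw [hr _ (by norm_num), h.reg_base]
  mem_edge := by rw [hm]; exact h.mem_edge
  mem_g := by rw [hm]; exact h.mem_g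
  mem_h := by rw [hm]; exact h.mem_h
  mem_out := by rw [hm]; exact h.mem_out

theorem cell_lt (u v : Fin n) : n * u + v < n * n := by
  have h₁ : n * (u + 1) ≤ n * n := Nat.mul_le_mul_left n u.2
  rw [Nat.mul_add] at h₁
  have := v.2
  omega

theorem cell_inj {u v u' v' : Fin n} : n * u + v = n * u' + v' ↔ u = u' ∧ v = v' := by
  constructor
  · intro h
    have hn : 0 < n := u.pos
    have h₁ := congrArg (· / n) h
    have h₂ := congrArg (· % n) h
    simp only [Nat.mul_add_div hn, Nat.div_eq_of_lt v.2, Nat.div_eq_of_lt v'.2, Nat.mul_add_mod,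
      Nat.mod_eq_of_lt v.2, Nat.mod_eq_of_lt v'.2] at h₁ h₂
    exact ⟨Fin.ext h₁, Fin.ext h₂⟩
  · rintro ⟨rfl, rfl⟩; rfl

/-- With `n * n` as an atom, `omega` can separate the memory regions: the input takes `2 + 2m ≤ base
n` cells since `m ≤ n * n`, and each matrix takes fewer than `base n`. -/
theorem base_eq (n : ℕ) : base n = 2 * (n * n) + 2 := by rw [base, mul_assoc]

/-- Conditions on four vertices, in the registers `5, …, 8`. -/
inductive Cond
  | eq (i j : Fin 4)
  | g (i j : Fin 4)
  | h (i j : Fin 4)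
  | not (c : Cond)
  | and (c d : Cond)
  | or (c d : Cond)

/-- The truth value of a condition. -/
def Cond.sem (g h : Fin n → Fin n → Bool) (ρ : Fin 4 → Fin n) : Cond → Bool
  | .eq i j => ρ i = ρ j
  | .g i j => g (ρ i) (ρ j)
  | .h i j => h (ρ i) (ρ j)
  | .not c => !c.sem g h ρ
  | .and c d => c.sem g h ρ && d.sem g h ρ
  | .or c d => c.sem g h ρ || d.sem g h ρ

/-- The address of an entry of the first matrix. -/
def gAddr (i j : Fin 4) : Expr :=
  .op .add (.reg 11) (.op .add (.op .mul (.reg 2) (.reg (5 + i))) (.reg (5 + j)))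

/-- The address of an entry of the second matrix. -/
def hAddr (i j : Fin 4) : Expr := .op .add (.reg 11) (gAddr i j)

/-- The expression that computes a condition. -/
def Cond.toExpr : Cond → Expr
  | .eq i j => .op .eq (.reg (5 + i)) (.reg (5 + j))
  | .g i j => .load (gAddr i j)
  | .h i j => .load (hAddr i j)
  | .not c => .op .eq c.toExpr (.const 0)
  | .and c d => .op .mul c.toExpr d.toExpr
  | .or c d => .op .lt (.const 0) (.op .add c.toExpr d.toExpr)

theorem gAddr_spec (hs : Represents L σ s) (hW : 4 * base n ≤ W) {i j : Fin 4} {u v : Fin n}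
    (hi : s.reg (5 + i) = u) (hj : s.reg (5 + j) = v) :
    (gAddr i j).Fits W s ∧ (gAddr i j).eval s = base n + (n * u + v) := by
  have h₁ := base_eq n
  have h₂ := cell_lt u v
  have h₃ := u.2
  have h₄ := v.2
  have h₅ : n ≤ n * n := Nat.le_mul_self n
  simp only [gAddr, Expr.Fits, Expr.eval, BinOp.eval, hi, hj, hs.reg_n, hs.reg_base]
  exact ⟨⟨by omega, ⟨⟨by omega, by omega, by omega⟩, by omega, by omega⟩, by omega⟩, trivial⟩

theorem hAddr_spec (hs : Represents L σ s) (hW : 4 * base n ≤ W) {i j : Fin 4} {u v : Fin n}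
    (hi : s.reg (5 + i) = u) (hj : s.reg (5 + j) = v) :
    (hAddr i j).Fits W s ∧ (hAddr i j).eval s = base n + (base n + (n * u + v)) := by
  obtain ⟨h₁, h₂⟩ := gAddr_spec hs hW hi hj
  have h₃ := base_eq n
  have h₄ := cell_lt u v
  simp only [hAddr, Expr.Fits, Expr.eval, BinOp.eval, h₂, hs.reg_base]
  exact ⟨⟨by omega, h₁, by omega⟩, trivial⟩

/-- Truth values are 0 and 1, so products, sums and comparisons compute the connectives without
overflow. Nothing is short-circuited, which makes the cost independent of the state. -/
theorem Cond.toExpr_spec (hs : Represents L σ s) (hW : 4 * base n ≤ W) {ρ : Fin 4 → Fin n}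
    (hρ : ∀ i : Fin 4, s.reg (5 + i) = ρ i) (c : Cond) :
    c.toExpr.Fits W s ∧ c.toExpr.eval s = (c.sem σ.g σ.h ρ).toNat := by
  have h₁ := base_eq n
  have hn : n ≤ n * n := Nat.le_mul_self n
  induction c with
  | eq i j =>
    have h₂ := (ρ i).2
    have h₃ := (ρ j).2
    simp only [toExpr, Expr.Fits, Expr.eval, BinOp.eval, hρ, sem, Fin.ext_iff]
    refine ⟨⟨by omega, by omega, ?_⟩, ?_⟩
    · split <;> omega
    · split <;> simp_all
  | g i j =>
    obtain ⟨h₂, h₃⟩ := gAddr_spec hs hW (hρ i) (hρ j)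
    simp only [toExpr, Expr.Fits, Expr.eval, h₃, sem, hs.mem_g, h₂, true_and, and_true]
    have := Bool.toNat_le (σ.g (ρ i) (ρ j))
    omega
  | h i j =>
    obtain ⟨h₂, h₃⟩ := hAddr_spec hs hW (hρ i) (hρ j)
    simp only [toExpr, Expr.Fits, Expr.eval, h₃, sem, hs.mem_h, h₂, true_and, and_true]
    have := Bool.toNat_le (σ.h (ρ i) (ρ j))
    omega
  | not c ih =>
    simp only [toExpr, Expr.Fits, Expr.eval, BinOp.eval, ih.1, ih.2, sem]
    cases c.sem σ.g σ.h ρ <;> (simp; try omega)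
  | and c d ihc ihd =>
    simp only [toExpr, Expr.Fits, Expr.eval, BinOp.eval, ihc.1, ihc.2, ihd.1, ihd.2, sem]
    cases c.sem σ.g σ.h ρ <;> cases d.sem σ.g σ.h ρ <;> (simp; try omega)
  | or c d ihc ihd =>
    simp only [toExpr, Expr.Fits, Expr.eval, BinOp.eval, ihc.1, ihc.2, ihd.1, ihd.2, sem]
    cases c.sem σ.g σ.h ρ <;> cases d.sem σ.g σ.h ρ <;> (simp; try omega)

/-- The condition `c` holds for `a`, `b` and some vertices `x` and `y`. -/
def Cond.Exists (c : Cond) (σ : Data n) (a b : Fin n) : Prop :=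
  ∃ x y, c.sem σ.g σ.h ![a, b, x, y] = true

/-- Search for vertices `x` and `y` with the condition `c`, with the answer in register `9`. -/
def scan (c : Cond) : Program :=
  .seq (.assign 9 (.const 0))
    (forLoop 7 2 (forLoop 8 2 (.cond c.toExpr (.assign 9 (.const 1)) .skip)))

open Classical in
-- The invariant says that register `9` tells whether a witness occurs among the pairs
-- lexicographically before the current one.
theorem Runs.scan (hs : Represents L σ s) (hW : 4 * base n ≤ W) {a b : Fin n} (ha : s.reg 5 = a)
    (hb : s.reg 6 = b) (c : Cond) :
    Runs W (scan c) s (n * (n * (c.toExpr.cost + 11) + 14) + 8) fun s' => s'.mem = s.mem ∧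
      (∀ r, r < 7 ∨ 9 < r → s'.reg r = s.reg r) ∧
      s'.reg 9 = if c.Exists σ a b then 1 else 0 := by
  have hW1 : 1 ≤ W := by have := base_eq n; omega
  have hnW : n ≤ W := by have := base_eq n; have := Nat.le_mul_self n; omega
  refine (Runs.seq (Q' := fun s' => s' = s.setReg 9 0) (Runs.assign (e := .const 0) (Nat.zero_le W) rfl)
    (T' := n * ((n * (c.toExpr.cost + 1 + 2 + 8) + 6) + 8) + 6) ?_).mono ?_ fun _ => id
  swap
  · simp only [Expr.cost]
    have : n * (c.toExpr.cost + 1 + 2 + 8) + 6 + 8 = n * (c.toExpr.cost + 11) + 14 := by ring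
    rw [this]
    omega
  rintro _ rfl
  refine (Runs.forLoop hW1 hnW (fun i s' => s'.reg 7 = i ∧ s'.mem = s.mem ∧
    (∀ r, r < 7 ∨ 9 < r → s'.reg r = s.reg r) ∧
    s'.reg 9 = if ∃ x y : Fin n, x < i ∧ c.sem σ.g σ.h ![a, b, x, y] = true then 1 else 0)
    ?_ ?_ ?_).mono le_rfl ?_
  · rintro i s' ⟨h₁, -, h₂, -⟩
    exact ⟨h₁, by rw [h₂ 2 (by norm_num), hs.reg_n]⟩
  · refine ⟨by simp, by simp, fun r hr => ?_, by simp⟩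
    have : r ≠ 7 ∧ r ≠ 9 := by omega
    simp [this]
  · rintro i hi s₁ ⟨h7, hmem, hreg, h9⟩
    refine (Runs.forLoop hW1 hnW (fun j s' => s'.reg 8 = j ∧ s'.reg 7 = i ∧ s'.mem = s.mem ∧
      (∀ r, r < 7 ∨ 9 < r → s'.reg r = s.reg r) ∧
      s'.reg 9 = if ∃ x y : Fin n, ((x : ℕ) < i ∨ (x : ℕ) = i ∧ (y : ℕ) < j) ∧
        c.sem σ.g σ.h ![a, b, x, y] = true then 1 else 0) ?_ ?_ ?_).mono le_rfl ?_
    · rintro i s' ⟨h₁, -, -, h₂, -⟩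
      exact ⟨h₁, by rw [h₂ 2 (by norm_num), hs.reg_n]⟩
    · refine ⟨by simp, by simp [h7], by simpa using hmem, fun r hr => ?_, by simp [h9]⟩
      have : r ≠ 8 := by omega
      simp [this, hreg r hr]
    · rintro j hj s₂ ⟨h8, h7, hmem, hreg, h9⟩
      have hs₂ : Represents L σ s₂ := hs.congr hmem fun r hr => hreg r (by omega)
      have hρ : ∀ k : Fin 4, s₂.reg (5 + k) = (![a, b, ⟨i, hi⟩, ⟨j, hj⟩] : Fin 4 → Fin n) k := by
        intro k
        fin_cases k
        · simpa [ha] using hreg 5 (by norm_num)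
        · simpa [hb] using hreg 6 (by norm_num)
        · simpa using h7
        · simpa using h8
      obtain ⟨hfit, hval⟩ := c.toExpr_spec hs₂ hW hρ
      have hsplit : (∃ x y : Fin n, ((x : ℕ) < i ∨ (x : ℕ) = i ∧ (y : ℕ) < j + 1) ∧
          c.sem σ.g σ.h ![a, b, x, y] = true) ↔ (∃ x y : Fin n, ((x : ℕ) < i ∨ (x : ℕ) = i ∧
          (y : ℕ) < j) ∧ c.sem σ.g σ.h ![a, b, x, y] = true) ∨
          c.sem σ.g σ.h ![a, b, ⟨i, hi⟩, ⟨j, hj⟩] = true := by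
        constructor
        · rintro ⟨x, y, hxy, h⟩
          by_cases he : (x : ℕ) = i ∧ (y : ℕ) = j
          · obtain ⟨rfl, rfl⟩ := he
            exact Or.inr h
          · exact Or.inl ⟨x, y, by omega, h⟩
        · rintro (⟨x, y, hxy, h⟩ | h)
          · exact ⟨x, y, by omega, h⟩
          · exact ⟨_, _, Or.inr ⟨rfl, Nat.lt_succ_self j⟩, h⟩
      refine (Runs.cond hfit (T := 2) (fun hc => ?_) fun hc => ?_).mono le_rfl fun _ => id
      · refine Runs.assign (e := .const 1) hW1 ⟨by simp [h8], by simp, by simp [h7],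
          by simpa using hmem, fun r hr => ?_, ?_⟩
        · have : r ≠ 8 ∧ r ≠ 9 := by omega
          simp [this, hreg r hr]
        · rw [if_pos]
          · simp [Expr.eval]
          · rw [hsplit]
            right
            rw [hval] at hc
            simpa using hc
      · refine (Runs.skip ⟨h8, by simp, by simp [h7], by simpa using hmem, fun r hr => ?_, ?_⟩).mono
          (by norm_num) fun _ => id
        · have : r ≠ 8 := by omega
          simp [this, hreg r hr]
        · have hf : ¬ c.sem σ.g σ.h ![a, b, ⟨i, hi⟩, ⟨j, hj⟩] = true := by
            intro h
            rw [hval, h] at hc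
            simp at hc
          simp only [hsplit, hf]
          simpa using h9
    · rintro s' ⟨-, h7, hmem, hreg, h9⟩
      refine ⟨h7, by simp, by simpa using hmem, fun r hr => ?_, ?_⟩
      · have : r ≠ 7 := by omega
        simp [this, hreg r hr]
      · rw [State.setReg_reg, if_neg (by norm_num), h9]
        -- At the end of a row the bound on `y` is vacuous, and the pairs seen are those with `x < i
        -- + 1`.
        refine if_congr (exists₂_congr fun x y => and_congr_left fun _ => ?_) rfl rfl
        have := y.2
        omega
  · rintro s' ⟨-, hmem, hreg, h9⟩
    refine ⟨hmem, hreg, h9.trans (if_congr (exists₂_congr fun x y => ?_) rfl rfl)⟩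
    simp

/-- What is done when a search has the required answer. -/
inductive Act
  | setG
  | setH
  | fail
  | emit

/-- A symmetric relation with another related pair. -/
def insertPair (g : Fin n → Fin n → Bool) (a b : Fin n) : Fin n → Fin n → Bool :=
  fun u v => g u v || (u = a && v = b) || (u = b && v = a)

/-- The effect of an action on the data. -/
def Act.run (σ : Data n) (a b : Fin n) : Act → Data n
  | .setG => { σ with g := insertPair σ.g a b }
  | .setH => { σ with h := insertPair σ.h a b }
  | .fail => { σ with ok := false }
  | .emit => { σ with out := σ.out ++ [(a, b)] }

/-- The address of the next free cell of the output. -/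
def outAddr : Expr := .op .add (.op .add (.reg 1) (.const 2)) (.op .mul (.const 2) (.reg 10))

/-- The program of an action. -/
def Act.prog : Act → Program
  | .setG => .seq (.store (gAddr 0 1) (.const 1)) (.store (gAddr 1 0) (.const 1))
  | .setH => .seq (.store (hAddr 0 1) (.const 1)) (.store (hAddr 1 0) (.const 1))
  | .fail => .assign 0 (.const 0)
  | .emit => .seq (.store outAddr (.reg 5)) (.seq (.store (.op .add outAddr (.const 1)) (.reg 6))
      (.assign 10 (.op .add (.reg 10) (.const 1))))

theorem Runs.act (hs : Represents L σ s) (hL : L.length ≤ n * n)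
    (hW : 4 * base n + 2 * σ.out.length ≤ W) {a b : Fin n}
    (ha : s.reg 5 = a) (hb : s.reg 6 = b) (c : Act) :
    Runs W c.prog s 40 fun s' => Represents L (c.run σ a b) s' ∧ s'.reg 4 = s.reg 4 := by
  have hW' : 4 * base n ≤ W := by omega
  have hbase := base_eq n
  have hnn := Nat.le_mul_self n
  have h1 : (1 : ℕ) ≤ W := by omega
  have ha' : s.reg (5 + ((0 : Fin 4) : ℕ)) = a := ha
  have hb' : s.reg (5 + ((1 : Fin 4) : ℕ)) = b := hb
  cases c with
  | setG =>
    obtain ⟨f₁, e₁⟩ := gAddr_spec hs hW' ha' hb'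
    obtain ⟨f₂, e₂⟩ := gAddr_spec hs hW' hb' ha'
    have hab := cell_lt a b
    have hba := cell_lt b a
    refine (Runs.seq (Q' := fun s' => s' = s.setMem (base n + (n * a + b)) 1)
      (Runs.store f₁ (e := .const 1) h1 (by rw [e₁]; rfl)) (T' := 9) ?_).mono (by decide)
      fun _ => id
    rintro _ rfl
    refine (Runs.store (a := gAddr 1 0) (e := .const 1) (s := s.setMem (base n + (n * a + b)) 1)
      (by simpa [gAddr, Expr.Fits, Expr.eval] using f₂) h1 ?_).mono (by decide) fun _ => id
    rw [show (gAddr 1 0).eval (s.setMem (base n + (n * a + b)) 1) = _ from e₂]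
    refine ⟨⟨hs.reg_ok, hs.reg_out, hs.reg_n, hs.reg_m, hs.reg_count, hs.reg_base, fun i hi => ?_,
      fun u v => ?_, fun u v => ?_, fun k hk => ?_⟩, rfl⟩ <;>
      simp only [State.setMem_mem, Expr.eval]
    · rw [if_neg (by omega), if_neg (by omega), if_neg (by omega), if_neg (by omega)]
      exact hs.mem_edge i hi
    · simp only [Nat.add_left_cancel_iff, cell_inj, hs.mem_g, Act.run, insertPair]
      by_cases h₁ : u = b ∧ v = a
      · simp [h₁]
      · by_cases h₂ : u = a ∧ v = b
        · simp [h₂]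
        · rw [if_neg h₁, if_neg h₂]
          simp only [← Bool.decide_and, h₁, h₂, decide_false, Bool.or_false]
    · have := cell_lt u v
      rw [if_neg (by omega), if_neg (by omega)]
      exact hs.mem_h u v
    · rw [if_neg (by omega), if_neg (by omega)]
      exact hs.mem_out k hk
  | setH =>
    obtain ⟨f₁, e₁⟩ := hAddr_spec hs hW' ha' hb'
    obtain ⟨f₂, e₂⟩ := hAddr_spec hs hW' hb' ha'
    have hab := cell_lt a b
    have hba := cell_lt b a
    refine (Runs.seq (Q' := fun s' => s' = s.setMem (base n + (base n + (n * a + b))) 1)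
      (Runs.store f₁ (e := .const 1) h1 (by rw [e₁]; rfl)) (T' := 11) ?_).mono (by decide)
      fun _ => id
    rintro _ rfl
    refine (Runs.store (a := hAddr 1 0) (e := .const 1)
      (s := s.setMem (base n + (base n + (n * a + b))) 1)
      (by simpa [hAddr, gAddr, Expr.Fits, Expr.eval] using f₂) h1 ?_).mono (by decide) fun _ => id
    rw [show (hAddr 1 0).eval (s.setMem (base n + (base n + (n * a + b))) 1) = _ from e₂]
    refine ⟨⟨hs.reg_ok, hs.reg_out, hs.reg_n, hs.reg_m, hs.reg_count, hs.reg_base, fun i hi => ?_,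
      fun u v => ?_, fun u v => ?_, fun k hk => ?_⟩, rfl⟩ <;>
      simp only [State.setMem_mem, Expr.eval]
    · rw [if_neg (by omega), if_neg (by omega), if_neg (by omega), if_neg (by omega)]
      exact hs.mem_edge i hi
    · have := cell_lt u v
      rw [if_neg (by omega), if_neg (by omega)]
      exact hs.mem_g u v
    · simp only [Nat.add_left_cancel_iff, cell_inj, hs.mem_h, Act.run, insertPair]
      by_cases h₁ : u = b ∧ v = a
      · simp [h₁]
      · by_cases h₂ : u = a ∧ v = b
        · simp [h₂]
        · rw [if_neg h₁, if_neg h₂]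
          simp only [← Bool.decide_and, h₁, h₂, decide_false, Bool.or_false]
    · rw [if_neg (by omega), if_neg (by omega)]
      exact hs.mem_out k hk
  | fail =>
    refine (Runs.assign (e := .const 0) (Nat.zero_le W) ⟨⟨?_, ?_, ?_, ?_, ?_, ?_, hs.mem_edge,
      hs.mem_g, hs.mem_h, hs.mem_out⟩, ?_⟩).mono (by decide) fun _ => id <;>
      simp [Act.run, Expr.eval, hs.reg_out, hs.reg_n, hs.reg_m, hs.reg_count, hs.reg_base]
  | emit =>
    -- The first free output cell; the two header cells are left for the epilogue.
    set d := 3 * base n + 2 + 2 * σ.out.length with hd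
    have e₁ : outAddr.eval s = d := by
      simp [outAddr, Expr.eval, BinOp.eval, hs.reg_out, hs.reg_count, hd]
    have f₁ : outAddr.Fits W s := by
      simp only [outAddr, Expr.Fits, Expr.eval, BinOp.eval, hs.reg_out, hs.reg_count]
      omega
    have ha₂ := a.2
    have hb₂ := b.2
    have hla : a ≤ W := by omega
    have hlb : b ≤ W := by omega
    refine (Runs.seq (Q' := fun s' => s' = s.setMem d a)
      (Runs.store f₁ (e := .reg 5) (by rw [Expr.Fits, ha]; exact hla)
        (by rw [e₁, Expr.eval, ha])) (T' := 16) ?_).mono (by decide) fun _ => id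
    rintro _ rfl
    refine (Runs.seq (Q' := fun s' => s' = (s.setMem d a).setMem (d + 1) b)
      (Runs.store (a := .op .add outAddr (.const 1)) (e := .reg 6) (s := s.setMem d a)
        ?_ (by rw [Expr.Fits, State.setMem_reg, hb]; exact hlb) ?_) (T' := 4) ?_).mono (by decide)
      fun _ => id
    · refine ⟨f₁, h1, ?_⟩
      change outAddr.eval s + 1 ≤ W
      rw [e₁]
      omega
    · change (s.setMem d a).setMem (outAddr.eval s + 1) (s.reg 6) = _
      rw [e₁, hb]
    rintro _ rfl
    refine (Runs.assign (e := .op .add (.reg 10) (.const 1)) ?_ ⟨⟨?_, ?_, ?_, ?_, ?_, ?_, ?_, ?_, ?_,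
      ?_⟩, ?_⟩).mono (by decide) fun _ => id
    · simp only [Expr.Fits, Expr.eval, BinOp.eval, State.setMem_reg, hs.reg_count]
      omega
    · simpa [Act.run] using hs.reg_ok
    · simpa using hs.reg_out
    · simpa using hs.reg_n
    · simpa using hs.reg_m
    · simp [Act.run, Expr.eval, BinOp.eval, hs.reg_count]
    · simpa using hs.reg_base
    · intro i hi
      simp only [State.setReg_mem, State.setMem_mem]
      rw [if_neg (by omega), if_neg (by omega), if_neg (by omega), if_neg (by omega)]
      exact hs.mem_edge i hi
    · intro u v
      have := cell_lt u v
      simp only [State.setReg_mem, State.setMem_mem]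
      rw [if_neg (by omega), if_neg (by omega)]
      exact hs.mem_g u v
    · intro u v
      have := cell_lt u v
      simp only [State.setReg_mem, State.setMem_mem]
      rw [if_neg (by omega), if_neg (by omega)]
      exact hs.mem_h u v
    · intro k hk
      have hfl : flatten (σ.out ++ [(a, b)]) = flatten σ.out ++ [(a : ℕ), (b : ℕ)] := by
        simp [flatten]
      have hlen := length_flatten σ.out
      simp only [Act.run, List.length_append, List.length_singleton] at hk
      simp only [State.setReg_mem, State.setMem_mem, Act.run, hfl]
      rcases lt_trichotomy k (2 * σ.out.length) with h | h | h
      · rw [if_neg (by omega), if_neg (by omega), List.getD_append _ _ _ _ (by omega)]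
        exact hs.mem_out k h
      · rw [if_neg (by omega), if_pos (by omega), List.getD_append_right _ _ _ _ (by omega)]
        simp [hlen, h]
      · obtain rfl : k = 2 * σ.out.length + 1 := by omega
        rw [if_pos (by omega), List.getD_append_right _ _ _ _ (by omega)]
        simp [hlen]
    · simp

end GraphPrograms

end WordRAM

/-- The invariant refers to the prefix already processed, hence induction from the right. -/
theorem List.foldl_invariant {α β : Type*} (f : β → α → β) (P : List α → β → Prop) (l : List α)
    (b : β) (h0 : P [] b) (hs : ∀ l' a b, a ∈ l → P l' b → P (l' ++ [a]) (f b a)) :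
    P l (l.foldl f b) := by
  induction l using List.reverseRecOn with
  | nil => exact h0
  | append_singleton l a ih =>
    rw [List.foldl_append]
    exact hs _ _ _ (by simp) (ih fun l' a' b h => hs l' a' b (by simp [h]))

namespace WordRAM

/-! ### Phases: one search and one conditional action per edge; set-up and output. -/

section Phases

variable {n : ℕ} {L : List (Fin n × Fin n)} {σ : Data n} {s s' : State} {W : ℕ}

/-- For every edge `ab` of the input list, search for `x` and `y` with a condition, and perform an
action if the answer is as required. -/
structure Phase where
  cond : Cond
  answer : Bool
  act : Act
  swapped : Bool

/-- The address of an end of the edge whose number is in register `4`. -/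
def endAddr (k : ℕ) : Expr := .op .add (.const (2 + k)) (.op .mul (.const 2) (.reg 4))

/-- The program of a phase. -/
def Phase.prog (ph : Phase) : Program :=
  forLoop 4 3 (.seq (.assign 5 (.load (endAddr ph.swapped.toNat)))
    (.seq (.assign 6 (.load (endAddr (!ph.swapped).toNat)))
      (.seq (scan ph.cond)
        (.cond (.op .eq (.reg 9) (.const ph.answer.toNat)) ph.act.prog .skip))))

open Classical in
/-- The effect of a phase for one edge. -/
noncomputable def Phase.step (ph : Phase) (σ : Data n) (e : Fin n × Fin n) : Data n :=
  if ph.cond.Exists σ e.1 e.2 ↔ ph.answer = true then ph.act.run σ e.1 e.2 else σ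

theorem Phase.step_pos {ph : Phase} {e : Fin n × Fin n}
    (h : ph.cond.Exists σ e.1 e.2 ↔ ph.answer = true) : ph.step σ e = ph.act.run σ e.1 e.2 :=
  if_pos h

theorem Phase.step_neg {ph : Phase} {e : Fin n × Fin n}
    (h : ¬ (ph.cond.Exists σ e.1 e.2 ↔ ph.answer = true)) : ph.step σ e = σ :=
  if_neg h

/-- The edges with the orientation in which a phase considers them. -/
def Phase.edges (ph : Phase) (L : List (Fin n × Fin n)) : List (Fin n × Fin n) :=
  if ph.swapped then L.map Prod.swap else L

/-- The effect of a phase. -/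
noncomputable def Phase.run (ph : Phase) (L : List (Fin n × Fin n)) (σ : Data n) : Data n :=
  (ph.edges L).foldl ph.step σ

theorem Phase.length_edges (ph : Phase) (L : List (Fin n × Fin n)) :
    (ph.edges L).length = L.length := by
  rw [edges]; split <;> simp

theorem Phase.length_out_foldl (ph : Phase) (l : List (Fin n × Fin n)) (σ : Data n) :
    (l.foldl ph.step σ).out.length ≤ σ.out.length + l.length := by
  refine List.foldl_invariant ph.step (fun l' σ' => σ'.out.length ≤ σ.out.length + l'.length) l σ
    le_rfl fun l' e σ' _ h => ?_
  have : (ph.step σ' e).out.length ≤ σ'.out.length + 1 := by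
    rw [step]
    split
    · cases ph.act <;> simp [Act.run]
    · omega
  simp only [List.length_append, List.length_singleton]
  omega

open Classical in
theorem Runs.phase (hs : Represents L σ s) (hL : L.length ≤ n * n) (ph : Phase)
    (hW : 4 * base n + 2 * (σ.out.length + L.length) ≤ W) :
    Runs W ph.prog s ((ph.cond.toExpr.cost + 150) * (n ^ 2 * L.length + 1))
      (Represents L (ph.run L σ)) := by
  have hbase := base_eq n
  have hnn := Nat.le_mul_self n
  refine (Runs.forLoop (T := n * (n * (ph.cond.toExpr.cost + 11) + 14) + 70) (N := L.length)
    (by omega) (by omega)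
    (fun i s' => s'.reg 4 = i ∧ Represents L (((ph.edges L).take i).foldl ph.step σ) s')
    ?_ ?_ ?_).mono ?_ ?_
  · rintro i s' ⟨h₁, h₂⟩
    exact ⟨h₁, h₂.reg_m⟩
  · refine ⟨by simp, hs.congr rfl fun r hr => ?_⟩
    have : r ≠ 4 := by omega
    simp [this]
  · rintro i hi s₁ ⟨h4, h₁⟩
    set σ' := ((ph.edges L).take i).foldl ph.step σ with hσ'
    have hout : σ'.out.length ≤ σ.out.length + L.length := by
      refine (ph.length_out_foldl _ σ).trans ?_
      have := ph.length_edges L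
      rw [List.length_take]
      omega
    have hi' : i < (ph.edges L).length := by rwa [ph.length_edges]
    obtain ⟨a, b, hab⟩ : ∃ a b, (ph.edges L)[i] = (a, b) := ⟨_, _, rfl⟩
    have hmem : s₁.mem (2 + ph.swapped.toNat + 2 * i) = a ∧
        s₁.mem (2 + (!ph.swapped).toNat + 2 * i) = b := by
      obtain ⟨h₂, h₃⟩ := h₁.mem_edge i hi
      simp only [Phase.edges] at hab
      cases hsw : ph.swapped
      · simp only [hsw, Bool.false_eq_true, if_false] at hab
        rw [hab] at h₂ h₃
        exact ⟨h₂, h₃⟩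
      · simp only [hsw, if_true, List.getElem_map, Prod.swap, Prod.mk.injEq] at hab
        rw [← hab.1, ← hab.2]
        exact ⟨h₃, h₂⟩
    have hadr : ∀ (k : Bool) (s₂ : State), s₂.reg 4 = i →
        (endAddr k.toNat).Fits W s₂ ∧ (endAddr k.toNat).eval s₂ = 2 + k.toNat + 2 * i := by
      intro k s₂ h4
      have := Bool.toNat_le k
      simp only [endAddr, Expr.Fits, Expr.eval, BinOp.eval, h4]
      exact ⟨⟨by omega, ⟨by omega, by omega, by omega⟩, by omega⟩, trivial⟩
    have haW : (a : ℕ) ≤ W := by have := a.2; omega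
    have hbW : (b : ℕ) ≤ W := by have := b.2; omega
    refine (Runs.seq (Q' := fun s₂ => s₂.reg 4 = i ∧ s₂.reg 5 = a ∧ s₂.mem = s₁.mem ∧
      Represents L σ' s₂) (Runs.assign ?_ ?_) (T' := 7 + ((n * (n * (ph.cond.toExpr.cost + 11) + 14)
      + 8) + 44)) ?_).mono (by simp only [endAddr, Expr.cost]; omega) fun _ => id
    · refine ⟨(hadr _ _ h4).1, ?_⟩
      rw [(hadr _ _ h4).2, hmem.1]
      exact haW
    · refine ⟨by simp [h4], ?_, rfl, h₁.congr rfl fun r hr => ?_⟩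
      · simp only [State.setReg_reg, Expr.eval, (hadr _ _ h4).2, hmem.1, if_true]
      · have : r ≠ 5 := by omega
        simp [this]
    rintro s₂ ⟨h4, h5, hm, h₂⟩
    rw [← hm] at hmem
    refine (Runs.seq (Q' := fun s₃ => s₃.reg 4 = i ∧ s₃.reg 5 = a ∧ s₃.reg 6 = b ∧
      Represents L σ' s₃) (Runs.assign ?_ ?_) (T' := (n * (n * (ph.cond.toExpr.cost + 11) + 14)
      + 8) + 44) ?_).mono (by simp only [endAddr, Expr.cost]; omega) fun _ => id
    · refine ⟨(hadr _ _ h4).1, ?_⟩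
      rw [(hadr _ _ h4).2, hmem.2]
      exact hbW
    · refine ⟨by simp [h4], by simp [h5], ?_, h₂.congr rfl fun r hr => ?_⟩
      · simp only [State.setReg_reg, Expr.eval, (hadr _ _ h4).2, hmem.2, if_true]
      · have : r ≠ 6 := by omega
        simp [this]
    rintro s₃ ⟨h4, h5, h6, h₃⟩
    refine Runs.seq (Runs.scan h₃ (by omega) h5 h6 ph.cond) ?_
    rintro s₄ ⟨hm, hr, h9⟩
    have h₄ : Represents L σ' s₄ := h₃.congr hm fun r h => hr r (by omega)
    have hstep : ((ph.edges L).take (i + 1)).foldl ph.step σ = ph.step σ' (a, b) := by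
      rw [List.take_add_one, List.getElem?_eq_getElem hi', hab, List.foldl_append]
      rfl
    rw [hstep]
    have hv : (Expr.op .eq (.reg 9) (.const ph.answer.toNat)).eval s₄ ≠ 0 ↔
        (ph.cond.Exists σ' a b ↔ ph.answer = true) := by
      simp only [Expr.eval, BinOp.eval, h9]
      by_cases h : ph.cond.Exists σ' a b <;> cases ph.answer <;> simp [h]
    refine (Runs.cond (T := 40) ?_ (fun h => ?_) fun h => ?_).mono (by simp [Expr.cost]) fun _ => id
    · have := Bool.toNat_le ph.answer
      simp only [Expr.Fits, Expr.eval, BinOp.eval, h9]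
      refine ⟨?_, by omega, ?_⟩ <;> split_ifs <;> omega
    · rw [Phase.step_pos (hv.1 h)]
      refine (Runs.act h₄ hL (by omega) (by rw [hr 5 (by norm_num), h5])
        (by rw [hr 6 (by norm_num), h6]) ph.act).mono le_rfl ?_
      rintro s₅ ⟨h₅, h4'⟩
      refine ⟨by rw [h4', hr 4 (by norm_num), h4], by simp, h₅.congr rfl fun r hr => ?_⟩
      have : r ≠ 4 := by omega
      simp [this]
    · rw [Phase.step_neg fun h' => hv.2 h' h]
      refine (Runs.skip ⟨by rw [hr 4 (by norm_num), h4], by simp, h₄.congr rfl fun r hr => ?_⟩).mono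
        (by norm_num) fun _ => id
      have : r ≠ 4 := by omega
      simp [this]
  · rcases Nat.eq_zero_or_pos L.length with h | h
    · simp [h]
    · have hn : 1 ≤ n := by
        by_contra hn
        obtain rfl : n = 0 := by omega
        omega
      -- An edge forces `1 ≤ n`, so the lower-order terms are absorbed into `n ^ 2`: `103 = 11 + 14
      -- + 78`.
      have h₁ : n * (n * (ph.cond.toExpr.cost + 11) + 14) + 70 + 8 ≤
          (ph.cond.toExpr.cost + 103) * n ^ 2 := by nlinarith
      have h₂ := Nat.mul_le_mul_left L.length h₁
      nlinarith
  · rintro s' ⟨-, h⟩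
    rwa [← ph.length_edges L, List.take_length] at h

/-- The phases of a list one after the other. -/
def phasesProg : List Phase → Program
  | [] => .skip
  | ph :: l => .seq ph.prog (phasesProg l)

/-- A bound for the number of steps of a list of phases per edge and pair of vertices. -/
def phasesCost : List Phase → ℕ
  | [] => 1
  | ph :: l => ph.cond.toExpr.cost + 150 + phasesCost l

/-- The demand on the word size crudely lets every phase emit every edge. -/
theorem Runs.phases (l : List Phase) (hs : Represents L σ s) (hL : L.length ≤ n * n)
    (hW : 4 * base n + 2 * (σ.out.length + l.length * L.length) ≤ W) :
    Runs W (phasesProg l) s (phasesCost l * (n ^ 2 * L.length + 1))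
      (Represents L (l.foldl (fun σ ph => ph.run L σ) σ)) := by
  induction l generalizing σ s with
  | nil => exact (Runs.skip hs).mono (by simp [phasesCost]) fun _ => id
  | cons ph l ih =>
    rw [phasesProg, phasesCost, add_mul]
    rw [List.length_cons, add_mul, one_mul] at hW
    refine Runs.seq (Runs.phase hs hL ph (by omega)) fun s' hs' => ih hs' ?_
    have := ph.length_out_foldl (ph.edges L) σ
    rw [ph.length_edges] at this
    change 4 * base n + 2 * (((ph.edges L).foldl ph.step σ).out.length + _) ≤ W
    omega

/-- Preparation: the registers are set up. -/
def prologue : Program :=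
  .seq (.assign 0 (.const 1)) (.seq (.assign 2 (.load (.const 0)))
    (.seq (.assign 3 (.load (.const 1)))
      (.seq (.assign 11 (.op .add (.op .mul (.op .mul (.const 2) (.reg 2)) (.reg 2)) (.const 2)))
        (.assign 1 (.op .mul (.const 3) (.reg 11))))))

/-- The data before the first phase. -/
def Data.init (n : ℕ) : Data n := ⟨fun _ _ => false, fun _ _ => false, true, []⟩

theorem Runs.prologue (hL : L.length ≤ n * n) (hW : 4 * base n ≤ W) :
    Runs W prologue (initial (encodeGraph n L)) 30 (Represents L (Data.init n)) := by
  have hbase : base n = 2 * n * n + 2 := rfl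
  have hbase' := base_eq n
  have hnn := Nat.le_mul_self n
  have h0 : (initial (encodeGraph n L)).mem 0 = n := rfl
  have h1 : (initial (encodeGraph n L)).mem 1 = L.length := rfl
  have hlen : (encodeGraph n L).length = 2 * L.length + 2 := by
    rw [← length_flatten]; rfl
  -- The input ends before `base n`, so both matrices are already zero. Clearing them would exceed
  -- the time bound for graphs without edges.
  have hz : ∀ a, base n ≤ a → (initial (encodeGraph n L)).mem a = 0 := fun a ha =>
    List.getD_eq_default _ _ (by omega)
  refine (Runs.seq (Runs.assign (e := .const 1) (Q := fun s => s =
    (initial (encodeGraph n L)).setReg 0 1) (show 1 ≤ W by omega) rfl) (T' := 26) ?_).mono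
    (by decide) fun _ => id
  rintro _ rfl
  refine (Runs.seq (Runs.assign (e := .load (.const 0)) (Q := fun s => s =
    ((initial (encodeGraph n L)).setReg 0 1).setReg 2 n) ⟨Nat.zero_le W, ?_⟩ ?_)
    (T' := 20) ?_).mono (by decide) fun _ => id
  · change (initial (encodeGraph n L)).mem 0 ≤ W
    omega
  · rw [Expr.eval, Expr.eval, State.setReg_mem, h0]
  rintro _ rfl
  refine (Runs.seq (Runs.assign (e := .load (.const 1)) (Q := fun s => s =
    (((initial (encodeGraph n L)).setReg 0 1).setReg 2 n).setReg 3 L.length)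
    ⟨show 1 ≤ W by omega, ?_⟩ ?_)
    (T' := 15) ?_).mono (by decide) fun _ => id
  · change (initial (encodeGraph n L)).mem 1 ≤ W
    omega
  · rw [Expr.eval, Expr.eval, State.setReg_mem, State.setReg_mem, h1]
  rintro _ rfl
  refine (Runs.seq (Runs.assign (Q := fun s => s =
    ((((initial (encodeGraph n L)).setReg 0 1).setReg 2 n).setReg 3 L.length).setReg 11 (base n))
    ?_ ?_) (T' := 4) ?_).mono (by decide) fun _ => id
  · have : 2 * n * n = 2 * (n * n) := mul_assoc 2 n n
    simp [Expr.Fits, Expr.eval, BinOp.eval]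
    omega
  · simp [Expr.eval, BinOp.eval, hbase]
  rintro _ rfl
  refine Runs.assign (e := .op .mul (.const 3) (.reg 11)) ?_ ⟨?_, ?_, ?_, ?_, ?_, ?_, ?_, ?_, ?_, ?_⟩
  · simp [Expr.Fits, Expr.eval, BinOp.eval]
    omega
  · simp [Data.init]
  · simp [Expr.eval, BinOp.eval]
  · simp
  · simp
  · simp [Data.init, initial]
  · simp
  · intro i hi
    simp only [State.setReg_mem]
    obtain ⟨h₁, h₂⟩ := getD_flatten L i hi
    rw [← h₁, ← h₂, add_comm 2, add_comm 3]
    exact ⟨rfl, rfl⟩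
  · intro u v
    exact hz _ (by omega)
  · intro u v
    exact hz _ (by omega)
  · intro k hk
    simp [Data.init] at hk

/-- The numbers of vertices and edges are written in front of the edges. -/
def epilogue : Program :=
  .seq (.store (.reg 1) (.reg 2)) (.store (.op .add (.reg 1) (.const 1)) (.reg 10))

theorem Runs.epilogue (hs : Represents L σ s) (hW : 4 * base n + 2 * σ.out.length ≤ W) :
    Runs W epilogue s 10 fun s' => s'.reg 0 = σ.ok.toNat ∧
      s'.HoldsAt (s'.reg 1) (encodeGraph n σ.out) := by
  have hbase := base_eq n
  have hnn := Nat.le_mul_self n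
  refine (Runs.seq (Runs.store (a := .reg 1) (e := .reg 2) (Q := fun s' => s' =
    s.setMem (3 * base n) n) ?_ ?_ ?_) (T' := 5) ?_).mono (by decide) fun _ => id
  · rw [Expr.Fits, hs.reg_out]; omega
  · rw [Expr.Fits, hs.reg_n]; omega
  · rw [Expr.eval, Expr.eval, hs.reg_out, hs.reg_n]
  rintro _ rfl
  refine Runs.store (a := .op .add (.reg 1) (.const 1)) (e := .reg 10) ?_ ?_ ⟨hs.reg_ok, ?_⟩
  · simp only [Expr.Fits, Expr.eval, BinOp.eval, State.setMem_reg, hs.reg_out]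
    omega
  · simp only [Expr.Fits, State.setMem_reg, hs.reg_count]
    omega
  · simp only [State.HoldsAt, Expr.eval, BinOp.eval, State.setMem_reg, hs.reg_out, hs.reg_count,
      State.setMem_mem]
    have henc : encodeGraph n σ.out = n :: σ.out.length :: flatten σ.out := rfl
    rw [henc]
    intro i hi
    match i, hi with
    | 0, _ => simp
    | 1, _ => simp
    | k + 2, hk =>
      simp only [List.length_cons, length_flatten] at hk
      rw [if_neg (by omega), if_neg (by omega), List.getD_cons_succ, List.getD_cons_succ,
        ← hs.mem_out k (by omega)]
      congr 1
      omega

end Phases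

end WordRAM

namespace WordRAM

/-! ### The phases of the algorithm and their correctness. -/

section Correctness

variable {n : ℕ} {L : List (Fin n × Fin n)} {σ : Data n} {G F : SimpleGraph (Fin n)}

/-- Enters the input graph into the first matrix. -/
def readPhase : Phase := ⟨.eq 0 0, true, .setG, false⟩

/-- Finds the edges whose ends have two nonadjacent common neighbours. -/
def forcedPhase : Phase :=
  ⟨.and (.and (.and (.g 0 2) (.g 1 2)) (.and (.g 0 3) (.g 1 3)))
    (.and (.not (.eq 2 3)) (.not (.g 2 3))), true, .setH, false⟩

/-- Attaches a vertex to a neighbour if no edge of the partial root forbids it. -/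
def attachPhase (swapped : Bool) : Phase :=
  ⟨.and (.h 2 3) (.or (.eq 2 0) (.or (.and (.eq 2 1) (.not (.g 0 3)))
    (.and (.and (.g 0 2) (.g 0 3)) (.and (.not (.eq 2 1)) (.not (.eq 3 1)))))),
    false, .setH, swapped⟩

/-- Verifies the girth and that no two adjacent edges of the root miss an edge of the square. -/
def girthPhase (swapped : Bool) : Phase :=
  ⟨.and (.and (.h 0 1) (.and (.h 0 2) (.not (.eq 2 1))))
    (.or (.and (.and (.h 1 3) (.not (.eq 3 0))) (.or (.eq 2 3) (.g 2 3)))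
      (.or (.and (.and (.g 2 3) (.g 1 3)) (.and (.not (.eq 3 0)) (.not (.h 0 3))))
        (.not (.g 1 2)))), true, .fail, swapped⟩

/-- Verifies that every edge of the graph is obtained from the root. -/
def coverPhase : Phase := ⟨.or (.h 0 1) (.and (.h 0 2) (.h 2 1)), false, .fail, false⟩

/-- Outputs the edges of the root. -/
def emitPhase : Phase := ⟨.h 0 1, true, .emit, false⟩

/-- The data hold the graphs `G` and `F`. -/
structure Data.Holds (σ : Data n) (G F : SimpleGraph (Fin n)) : Prop where
  g : ∀ u v, σ.g u v = true ↔ G.Adj u v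
  h : ∀ u v, σ.h u v = true ↔ F.Adj u v

/-- The ends of `ab` have two nonadjacent common neighbours. -/
def NonadjCommon (G : SimpleGraph (Fin n)) (a b : Fin n) : Prop :=
  ∃ x y, (G.Adj a x ∧ G.Adj b x) ∧ (G.Adj a y ∧ G.Adj b y) ∧ x ≠ y ∧ ¬ G.Adj x y

section Semantics

variable {g h : Fin n → Fin n → Bool} {ρ : Fin 4 → Fin n} {c d : Cond} {i j : Fin 4}

theorem Cond.sem_eq : (Cond.eq i j).sem g h ρ = true ↔ ρ i = ρ j := decide_eq_true_iff

theorem Cond.sem_g : (Cond.g i j).sem g h ρ = true ↔ g (ρ i) (ρ j) = true := Iff.rfl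

theorem Cond.sem_h : (Cond.h i j).sem g h ρ = true ↔ h (ρ i) (ρ j) = true := Iff.rfl

theorem Cond.sem_not : (Cond.not c).sem g h ρ = true ↔ ¬ c.sem g h ρ = true := by
  rw [Cond.sem, Bool.not_eq_true', Bool.not_eq_true]

theorem Cond.sem_and : (Cond.and c d).sem g h ρ = true ↔
    c.sem g h ρ = true ∧ d.sem g h ρ = true := Bool.and_eq_true_iff

theorem Cond.sem_or : (Cond.or c d).sem g h ρ = true ↔
    c.sem g h ρ = true ∨ d.sem g h ρ = true := Bool.or_eq_true_iff

end Semantics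

theorem exists_forced (hg : ∀ u v, σ.g u v = true ↔ G.Adj u v) (a b : Fin n) :
    forcedPhase.cond.Exists σ a b ↔ NonadjCommon G a b := by
  refine exists₂_congr fun x y => ?_
  simp [forcedPhase, Cond.sem_eq, Cond.sem_g, Cond.sem_not, Cond.sem_and, hg, and_assoc]

theorem exists_attach (h : σ.Holds G F) (t : Bool) (a b : Fin n) :
    (attachPhase t).cond.Exists σ a b ↔ ∃ x y, F.Adj x y ∧ Blocks G a b x y := by
  refine exists₂_congr fun x y => ?_
  simp [attachPhase, Cond.sem_eq, Cond.sem_g, Cond.sem_h, Cond.sem_not, Cond.sem_and,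
    Cond.sem_or, h.g, h.h, Blocks, and_assoc]

theorem exists_girth (h : σ.Holds G F) (t : Bool) (a b : Fin n) :
    (girthPhase t).cond.Exists σ a b ↔ ∃ x y, Violates G F a b x y := by
  refine exists₂_congr fun x y => ?_
  simp [girthPhase, Cond.sem_eq, Cond.sem_g, Cond.sem_h, Cond.sem_not, Cond.sem_and,
    Cond.sem_or, h.g, h.h, Violates, and_assoc]

theorem exists_cover (h : σ.Holds G F) (a b : Fin n) :
    coverPhase.cond.Exists σ a b ↔ F.Adj a b ∨ ∃ x, F.Adj a x ∧ F.Adj x b := by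
  simp only [Cond.Exists, coverPhase, Cond.sem, Bool.or_eq_true, Bool.and_eq_true, h.h]
  constructor
  · rintro ⟨x, y, h | h⟩
    · exact Or.inl h
    · exact Or.inr ⟨x, h⟩
  · rintro (h | ⟨x, h⟩)
    -- `a` stands in for vertices that the condition does not mention.
    · exact ⟨a, a, Or.inl h⟩
    · exact ⟨x, a, Or.inr h⟩

theorem exists_emit (h : σ.Holds G F) (a b : Fin n) :
    emitPhase.cond.Exists σ a b ↔ F.Adj a b := by
  simp only [Cond.Exists, emitPhase, Cond.sem, ← h.h]
  exact ⟨fun ⟨_, _, h⟩ => h, fun h => ⟨a, a, h⟩⟩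

theorem insertPair_eq_true {g : Fin n → Fin n → Bool} {a b u v : Fin n} :
    insertPair g a b u v = true ↔ g u v = true ∨ s(a, b) = s(u, v) := by
  simp only [insertPair, Bool.or_eq_true, Bool.and_eq_true, decide_eq_true_eq, Sym2.eq_iff,
    or_assoc, eq_comm (a := a), eq_comm (a := b)]
  tauto

theorem adj_iff_of_isEdgeList (hL : IsEdgeList G L) (u v : Fin n) :
    G.Adj u v ↔ ∃ e ∈ L, s(e.1, e.2) = s(u, v) := by
  rw [← SimpleGraph.mem_edgeSet, ← hL.2, List.mem_map]

theorem run_readPhase (hL : IsEdgeList G L) (σ : Data n) (hσ : ∀ u v, σ.g u v = false) :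
    (∀ u v, (readPhase.run L σ).g u v = true ↔ G.Adj u v) ∧ (readPhase.run L σ).h = σ.h ∧
      (readPhase.run L σ).ok = σ.ok ∧ (readPhase.run L σ).out = σ.out := by
  simp only [adj_iff_of_isEdgeList hL]
  refine List.foldl_invariant readPhase.step (fun l σ' => (∀ u v, σ'.g u v = true ↔
    ∃ e ∈ l, s(e.1, e.2) = s(u, v)) ∧ σ'.h = σ.h ∧ σ'.ok = σ.ok ∧ σ'.out = σ.out) L σ
    ⟨by simp [hσ], rfl, rfl, rfl⟩ ?_
  rintro l e σ' - ⟨hg, hh, hok, hout⟩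
  -- The condition `eq 0 0` always holds, so every edge is entered.
  have : readPhase.step σ' e = Act.setG.run σ' e.1 e.2 :=
    Phase.step_pos (iff_of_true ⟨e.1, e.1, Cond.sem_eq.2 rfl⟩ rfl)
  rw [this]
  refine ⟨fun u v => ?_, hh, hok, hout⟩
  simp only [Act.run, insertPair_eq_true, hg, List.mem_append, List.mem_singleton, or_and_right,
    exists_or, exists_eq_left]

/-- The search reads only the first matrix, which stays fixed, so the result does not depend on the
order of the edges. -/
theorem run_forcedPhase (hL : IsEdgeList G L) (σ : Data n) (hg : ∀ u v, σ.g u v = true ↔ G.Adj u v)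
    (hh : ∀ u v, σ.h u v = false) :
    ∃ F, F ≤ G ∧ (∀ u v, F.Adj u v ↔ G.Adj u v ∧ NonadjCommon G u v) ∧
      (forcedPhase.run L σ).Holds G F ∧ (forcedPhase.run L σ).ok = σ.ok ∧
      (forcedPhase.run L σ).out = σ.out := by
  have hsymm : ∀ u v, NonadjCommon G u v → NonadjCommon G v u := by
    rintro u v ⟨x, y, h₁, h₂, h₃⟩
    exact ⟨x, y, h₁.symm, h₂.symm, h₃⟩
  obtain ⟨h₁, h₂, h₃, h₄⟩ : (∀ u v, (forcedPhase.run L σ).g u v = true ↔ G.Adj u v) ∧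
      (∀ u v, (forcedPhase.run L σ).h u v = true ↔
        ∃ e ∈ L, s(e.1, e.2) = s(u, v) ∧ NonadjCommon G e.1 e.2) ∧
      (forcedPhase.run L σ).ok = σ.ok ∧ (forcedPhase.run L σ).out = σ.out := by
    refine List.foldl_invariant forcedPhase.step (fun l σ' =>
      (∀ u v, σ'.g u v = true ↔ G.Adj u v) ∧ (∀ u v, σ'.h u v = true ↔
      ∃ e ∈ l, s(e.1, e.2) = s(u, v) ∧ NonadjCommon G e.1 e.2) ∧ σ'.ok = σ.ok ∧ σ'.out = σ.out) L σ
      ⟨hg, by simp [hh], rfl, rfl⟩ ?_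
    rintro l e σ' - ⟨hg, hh, hok, hout⟩
    by_cases hc : forcedPhase.cond.Exists σ' e.1 e.2
    · rw [Phase.step_pos (iff_of_true hc rfl)]
      rw [exists_forced hg] at hc
      refine ⟨hg, fun u v => ?_, hok, hout⟩
      simp only [forcedPhase, Act.run, insertPair_eq_true, hh, List.mem_append, List.mem_singleton,
        or_and_right, exists_or, exists_eq_left, hc, and_true]
    · rw [Phase.step_neg fun h => hc (h.2 rfl)]
      rw [exists_forced hg] at hc
      refine ⟨hg, fun u v => ?_, hok, hout⟩
      simp only [hh, List.mem_append, List.mem_singleton,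
        or_and_right, exists_or, exists_eq_left, hc, and_false, or_false]
  refine ⟨⟨fun u v => G.Adj u v ∧ NonadjCommon G u v, ⟨fun u v h => ⟨h.1.symm, hsymm _ _ h.2⟩⟩,
    ⟨fun u h => h.1.ne rfl⟩⟩, fun u v h => h.1, fun u v => Iff.rfl, ⟨h₁, fun u v => ?_⟩, h₃, h₄⟩
  rw [h₂]
  change _ ↔ G.Adj u v ∧ NonadjCommon G u v
  rw [adj_iff_of_isEdgeList hL]
  constructor
  · rintro ⟨e, he, heq, hc⟩
    refine ⟨⟨e, he, heq⟩, ?_⟩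
    rcases Sym2.eq_iff.1 heq with ⟨rfl, rfl⟩ | ⟨rfl, rfl⟩
    · exact hc
    · exact hsymm _ _ hc
  · rintro ⟨⟨e, he, heq⟩, hc⟩
    refine ⟨e, he, heq, ?_⟩
    rcases Sym2.eq_iff.1 heq with ⟨rfl, rfl⟩ | ⟨rfl, rfl⟩
    · exact hc
    · exact hsymm _ _ hc

/-- The invariant of the attachment of the remaining vertices: the pairs `S` have been treated. -/
structure AttachInv (G : SimpleGraph (Fin n)) (S : List (Fin n × Fin n)) (σ : Data n)
    (F : SimpleGraph (Fin n)) : Prop where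
  le : F ≤ G
  holds : σ.Holds G F
  forced : ContainsForced G F
  blocked : ∀ e ∈ S, ∃ x y, F.Adj x y ∧ Blocks G e.1 e.2 x y
  extends_root : (∃ H, IsRoot G H) → ∃ H, IsRoot G H ∧ F ≤ H

/-- Earlier blocks persist because `F` only grows, and the treated pair ends up blocked either way:
by an old edge, or by itself as a new edge. -/
theorem AttachInv.step {S : List (Fin n × Fin n)} (h : AttachInv G S σ F) (t : Bool)
    {e : Fin n × Fin n} (he : G.Adj e.1 e.2) :
    ∃ F', AttachInv G (S ++ [e]) ((attachPhase t).step σ e) F' ∧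
      ((attachPhase t).step σ e).ok = σ.ok ∧ ((attachPhase t).step σ e).out = σ.out := by
  by_cases hc : (attachPhase t).cond.Exists σ e.1 e.2
  · rw [Phase.step_neg fun h => Bool.false_ne_true (h.1 hc)]
    rw [exists_attach h.holds] at hc
    refine ⟨F, ⟨h.le, h.holds, h.forced, fun e' he' => ?_, h.extends_root⟩, rfl, rfl⟩
    rcases List.mem_append.1 he' with h' | h'
    · exact h.blocked _ h'
    · rwa [List.mem_singleton.1 h']
  · rw [Phase.step_pos (iff_of_false hc Bool.false_ne_true)]
    rw [exists_attach h.holds] at hc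
    push Not at hc
    have hadj : ∀ u v, (F ⊔ SimpleGraph.edge e.1 e.2).Adj u v ↔ F.Adj u v ∨ s(e.1, e.2) = s(u, v) := by
      intro u v
      rw [SimpleGraph.sup_adj, SimpleGraph.edge_adj, Sym2.eq_iff]
      refine or_congr Iff.rfl ⟨fun h' => ?_, fun h' => ⟨?_, ?_⟩⟩
      · tauto
      · tauto
      · rcases h' with ⟨rfl, rfl⟩ | ⟨rfl, rfl⟩
        · exact he.ne
        · exact he.ne.symm
    have hle : ∀ {H : SimpleGraph (Fin n)}, F ≤ H → H.Adj e.1 e.2 →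
        F ⊔ SimpleGraph.edge e.1 e.2 ≤ H := by
      intro H hFH hH u v huv
      rcases (hadj u v).1 huv with huv | huv
      · exact hFH huv
      · rwa [← SimpleGraph.mem_edgeSet, ← huv]
    refine ⟨F ⊔ SimpleGraph.edge e.1 e.2, ⟨hle h.le he, ⟨h.holds.g, fun u v => ?_⟩,
      fun a b hab hf => (hadj a b).2 (Or.inl (h.forced a b hab hf)), fun e' he' => ?_,
      fun hr => ?_⟩, rfl, rfl⟩
    · rw [hadj, ← h.holds.h]
      exact insertPair_eq_true
    · rcases List.mem_append.1 he' with h' | h'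
      · obtain ⟨x, y, hxy, hb⟩ := h.blocked _ h'
        exact ⟨x, y, (hadj x y).2 (Or.inl hxy), hb⟩
      · rw [List.mem_singleton.1 h']
        exact ⟨e.1, e.2, (hadj _ _).2 (Or.inr rfl), Or.inl rfl⟩
    · obtain ⟨H, hH, hFH⟩ := h.extends_root hr
      -- The root containing the partial root may change at this step; only its existence is
      -- preserved.
      obtain ⟨H', hH', hFH', hadj'⟩ := hH.exists_attach hFH h.forced he hc
      exact ⟨H', hH', hle hFH' hadj'⟩

theorem AttachInv.run {S : List (Fin n × Fin n)} (h : AttachInv G S σ F) (t : Bool)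
    (hL : ∀ e ∈ L, G.Adj e.1 e.2) :
    ∃ F', AttachInv G (S ++ (attachPhase t).edges L) ((attachPhase t).run L σ) F' ∧
      ((attachPhase t).run L σ).ok = σ.ok ∧ ((attachPhase t).run L σ).out = σ.out := by
  have hL' : ∀ e ∈ (attachPhase t).edges L, G.Adj e.1 e.2 := by
    intro e he
    rw [Phase.edges] at he
    split at he
    · obtain ⟨e', he', rfl⟩ := List.mem_map.1 he
      exact (hL e' he').symm
    · exact hL e he
  refine List.foldl_invariant (attachPhase t).step (fun l σ' => ∃ F', AttachInv G (S ++ l) σ' F' ∧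
    σ'.ok = σ.ok ∧ σ'.out = σ.out) _ σ ⟨F, by simpa using h, rfl, rfl⟩ ?_
  rintro l e σ' he ⟨F', hF', h₁, h₂⟩
  obtain ⟨F'', hF'', h₃, h₄⟩ := hF'.step t (hL' e he)
  exact ⟨F'', by rwa [← List.append_assoc], h₃.trans h₁, h₄.trans h₂⟩

/-- A failing action touches neither matrix, so all edges are tested against the same graphs. -/
theorem run_fail (ph : Phase) (hact : ph.act = .fail) (σ : Data n)
    {P : Fin n → Fin n → Prop} (hP : ∀ σ' : Data n, σ'.g = σ.g → σ'.h = σ.h → ∀ a b,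
      (ph.cond.Exists σ' a b ↔ ph.answer = true) ↔ ¬ P a b) :
    (ph.run L σ).g = σ.g ∧ (ph.run L σ).h = σ.h ∧ (ph.run L σ).out = σ.out ∧
      ((ph.run L σ).ok = true ↔ σ.ok = true ∧ ∀ e ∈ ph.edges L, P e.1 e.2) := by
  refine List.foldl_invariant ph.step (fun l σ' => σ'.g = σ.g ∧ σ'.h = σ.h ∧ σ'.out = σ.out ∧
    (σ'.ok = true ↔ σ.ok = true ∧ ∀ e ∈ l, P e.1 e.2)) _ σ ⟨rfl, rfl, rfl, by simp⟩ ?_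
  rintro l e σ' - ⟨h₁, h₂, h₃, h₄⟩
  have hc := hP σ' h₁ h₂ e.1 e.2
  by_cases hif : ph.cond.Exists σ' e.1 e.2 ↔ ph.answer = true
  · rw [Phase.step_pos hif, hact]
    refine ⟨h₁, h₂, h₃, ?_⟩
    simp only [Act.run, Bool.false_eq_true, false_iff, not_and]
    exact fun _ hall => hc.1 hif (hall e (by simp))
  · rw [Phase.step_neg hif]
    refine ⟨h₁, h₂, h₃, ?_⟩
    have he : P e.1 e.2 := not_not.1 fun hn => hif (hc.2 hn)
    rw [h₄]
    simp only [List.mem_append, List.mem_singleton, or_imp, forall_and, forall_eq, he, and_true]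

open Classical in
theorem run_emitPhase (h : σ.Holds G F) : (emitPhase.run L σ).ok = σ.ok ∧
    (emitPhase.run L σ).out = σ.out ++ L.filter fun e => F.Adj e.1 e.2 := by
  have : (emitPhase.run L σ).Holds G F ∧ (emitPhase.run L σ).ok = σ.ok ∧
      (emitPhase.run L σ).out = σ.out ++ L.filter fun e => F.Adj e.1 e.2 := by
    refine List.foldl_invariant emitPhase.step (fun l σ' => σ'.Holds G F ∧ σ'.ok = σ.ok ∧
      σ'.out = σ.out ++ l.filter fun e => F.Adj e.1 e.2) L σ ⟨h, rfl, by simp⟩ ?_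
    rintro l e σ' - ⟨h₁, h₂, h₃⟩
    by_cases hc : emitPhase.cond.Exists σ' e.1 e.2
    · rw [Phase.step_pos (iff_of_true hc rfl)]
      rw [exists_emit h₁] at hc
      refine ⟨⟨h₁.g, h₁.h⟩, h₂, ?_⟩
      simp [emitPhase, Act.run, h₃, hc]
    · rw [Phase.step_neg fun h => hc (h.2 rfl)]
      rw [exists_emit h₁] at hc
      exact ⟨h₁, h₂, by simp [h₃, hc]⟩
  exact this.2

/-- The phases of the algorithm. -/
def phases : List Phase :=
  [readPhase, forcedPhase, attachPhase false, attachPhase true, girthPhase false, girthPhase true,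
    coverPhase, emitPhase]

/-- `F` is the final partial root. The flag is right by `isRoot_iff` whether or not a root exists;
if one exists, some root contains `F`, and equals it since all pairs are blocked. -/
theorem run_phases (hL : IsEdgeList G L) :
    let σ := phases.foldl (fun σ ph => ph.run L σ) (Data.init n)
    ∃ F, (σ.ok = true ↔ IsRoot G F) ∧ ((∃ H, IsRoot G H) → IsRoot G F) ∧
      IsEdgeList F σ.out := by
  classical
  intro σ
  have hmem := adj_iff_of_isEdgeList hL
  have hadj : ∀ e ∈ L, G.Adj e.1 e.2 := fun e he => (hmem _ _).2 ⟨e, he, rfl⟩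
  -- Asymmetric conditions must be treated for both orientations of each listed edge, hence the
  -- repeated phases.
  have hboth : ∀ P : Fin n → Fin n → Prop, (∀ a b, G.Adj a b → P a b) ↔
      (∀ e ∈ L, P e.1 e.2) ∧ ∀ e ∈ L.map Prod.swap, P e.1 e.2 := by
    intro P
    constructor
    · intro h
      refine ⟨fun e he => h _ _ (hadj e he), fun e he => ?_⟩
      obtain ⟨e', he', rfl⟩ := List.mem_map.1 he
      exact h _ _ (hadj e' he').symm
    · rintro ⟨h₁, h₂⟩ a b hab
      obtain ⟨e, he, heq⟩ := (hmem a b).1 hab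
      rcases Sym2.eq_iff.1 heq with ⟨rfl, rfl⟩ | ⟨rfl, rfl⟩
      · exact h₁ e he
      · exact h₂ e.swap (List.mem_map_of_mem he)
  obtain ⟨g₁, h₁, ok₁, out₁⟩ := run_readPhase hL (Data.init n) fun _ _ => rfl
  set σ₁ := readPhase.run L (Data.init n)
  obtain ⟨F₂, le₂, adj₂, holds₂, ok₂, out₂⟩ := run_forcedPhase hL σ₁ g₁ fun u v => by rw [h₁]; rfl
  set σ₂ := forcedPhase.run L σ₁
  have inv₂ : AttachInv G [] σ₂ F₂ := by
    refine ⟨le₂, holds₂, fun a b hab hf => (adj₂ a b).2 ⟨hab, hf⟩, by simp, ?_⟩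
    rintro ⟨H, hH⟩
    refine ⟨H, hH, fun a b hab => ?_⟩
    obtain ⟨hG, x, y, ⟨ax, bx⟩, ⟨ay, bY⟩, hxy, hn⟩ := (adj₂ a b).1 hab
    exact hH.adj_of_nonadj_common hG ax bx ay bY hxy hn
  obtain ⟨F₃, inv₃, ok₃, out₃⟩ := inv₂.run false hadj
  set σ₃ := (attachPhase false).run L σ₂
  obtain ⟨F, inv₄, ok₄, out₄⟩ := inv₃.run true hadj
  set σ₄ := (attachPhase true).run L σ₃
  have hg : ∀ (t : Bool) (σ' : Data n), σ'.g = σ₄.g → σ'.h = σ₄.h → ∀ a b,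
      ((girthPhase t).cond.Exists σ' a b ↔ (girthPhase t).answer = true) ↔
        ¬ ∀ x y, ¬ Violates G F a b x y := by
    intro t σ' hg hh a b
    have : σ'.Holds G F := ⟨by rw [hg]; exact inv₄.holds.g, by rw [hh]; exact inv₄.holds.h⟩
    rw [exists_girth this]
    simp [girthPhase]
  obtain ⟨g₅, h₅, out₅, ok₅⟩ := run_fail (L := L) (girthPhase false) rfl σ₄ (hg false)
  set σ₅ := (girthPhase false).run L σ₄
  obtain ⟨g₆, h₆, out₆, ok₆⟩ := run_fail (L := L) (girthPhase true) rfl σ₅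
    fun σ' hg' hh' => hg true σ' (hg'.trans g₅) (hh'.trans h₅)
  set σ₆ := (girthPhase true).run L σ₅
  have holds₆ : σ₆.Holds G F :=
    ⟨by rw [g₆, g₅]; exact inv₄.holds.g, by rw [h₆, h₅]; exact inv₄.holds.h⟩
  obtain ⟨g₇, h₇, out₇, ok₇⟩ := run_fail (L := L) coverPhase rfl σ₆
    (P := fun a b => F.Adj a b ∨ ∃ x, F.Adj a x ∧ F.Adj x b) fun σ' hg hh a b => by
      have : σ'.Holds G F := ⟨by rw [hg]; exact holds₆.g, by rw [hh]; exact holds₆.h⟩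
      rw [exists_cover this]
      simp [coverPhase]
  set σ₇ := coverPhase.run L σ₆
  have holds₇ : σ₇.Holds G F := ⟨by rw [g₇]; exact holds₆.g, by rw [h₇]; exact holds₆.h⟩
  obtain ⟨ok₈, out₈⟩ := run_emitPhase (L := L) holds₇
  have hσ : σ = emitPhase.run L σ₇ := rfl
  have hok : σ.ok = true ↔ IsRoot G F := by
    rw [hσ, ok₈, ok₇, ok₆, ok₅, ok₄, ok₃, ok₂, ok₁, isRoot_iff inv₄.le, hboth]
    refine and_congr ?_ ?_
    · simp only [Data.init, true_and]
      rfl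
    -- Being covered by the square is symmetric, so one orientation is enough.
    · constructor
      · intro h a b hab
        obtain ⟨e, he, heq⟩ := (hmem a b).1 hab
        have := h e he
        rcases Sym2.eq_iff.1 heq with ⟨rfl, rfl⟩ | ⟨rfl, rfl⟩
        · exact this
        · rcases this with h' | ⟨x, h', h''⟩
          · exact Or.inl h'.symm
          · exact Or.inr ⟨x, h''.symm, h'.symm⟩
      · exact fun h e he => h _ _ (hadj e he)
  refine ⟨F, hok, fun hr => ?_, ?_⟩
  · obtain ⟨H, hH, hFH⟩ := inv₄.extends_root hr
    rw [hH.eq_of_blocked hFH inv₄.forced ?_]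
    · exact hH
    · refine (hboth fun l b => ∃ x y, F.Adj x y ∧ Blocks G l b x y).2 ⟨fun e he => ?_,
        fun e he => ?_⟩
      · exact inv₄.blocked e (List.mem_append_left _ (List.mem_append_right _ he))
      · exact inv₄.blocked e (List.mem_append_right _ he)
  · have hout : σ.out = L.filter fun e => F.Adj e.1 e.2 := by
      rw [hσ, out₈, out₇, out₆, out₅, out₄, out₃, out₂, out₁]
      rfl
    rw [hout]
    refine ⟨hL.1.sublist (List.filter_sublist.map _), fun e => ?_⟩
    induction e with
    | _ u v =>
    simp only [List.mem_map, List.mem_filter, decide_eq_true_eq, SimpleGraph.mem_edgeSet]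
    constructor
    · rintro ⟨e, ⟨-, he⟩, heq⟩
      rwa [← SimpleGraph.mem_edgeSet, ← heq]
    · intro huv
      obtain ⟨e, he, heq⟩ := (hmem u v).1 (inv₄.le huv)
      refine ⟨e, ⟨he, ?_⟩, heq⟩
      rwa [← SimpleGraph.mem_edgeSet, heq]

end Correctness

end WordRAM

/-- One program for a word RAM with words of `O(log n)` bits decides for every graph `G` with `n`
vertices and `m` edges, given by a list of its edges, within `O(n² m + 1)` steps whether `G` is the
square of a graph of girth at least seven (register `0` is the answer, `1` or `0`), and outputs
such a square root, if there is one, as a list of edges (at the address in register `1`). -/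
theorem mainTheorem5 :
    ∃ (P : WordRAM.Program) (C k : ℕ),
      ∀ (n : ℕ) (G : SimpleGraph (Fin n)) (L : List (Fin n × Fin n)), IsEdgeList G L →
        ∃ (t : ℕ) (s : WordRAM.State),
          WordRAM.Exec ((n + 2) ^ k) P (WordRAM.initial (encodeGraph n L)) t s ∧
          t ≤ C * (n ^ 2 * G.edgeSet.ncard + 1) ∧
          ((∃ H : SimpleGraph (Fin n), IsSquareRootGirthSeven G H) →
            s.reg 0 = 1 ∧
            ∃ (H : SimpleGraph (Fin n)) (M : List (Fin n × Fin n)),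
              IsSquareRootGirthSeven G H ∧ IsEdgeList H M ∧
              s.HoldsAt (s.reg 1) (encodeGraph n M)) ∧
          ((¬ ∃ H : SimpleGraph (Fin n), IsSquareRootGirthSeven G H) → s.reg 0 = 0) := by
  open WordRAM in
  -- The 40 pays for the prologue (30) and the epilogue (10).
  refine ⟨.seq prologue (.seq (phasesProg phases) epilogue), phasesCost phases + 40, 8,
    fun n G L hL => ?_⟩
  have hcard : G.edgeSet.ncard = L.length := by
    classical
    have h : G.edgeSet = ((L.map fun p => s(p.1, p.2)).toFinset : Set (Sym2 (Fin n))) := by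
      ext e
      simp only [← hL.2 e, List.coe_toFinset, Set.mem_ofPred_eq]
    rw [h, Set.ncard_coe_finset, List.toFinset_card_of_nodup hL.1, List.length_map]
  have hlen : L.length ≤ n * n := by
    simpa using (List.Nodup.of_map _ hL.1).length_le_card
  -- Eight phases with at most `n * n` emitted edges of two cells each account for the term 16.
  have hW : 4 * base n + 16 * (n * n) ≤ (n + 2) ^ 8 := by
    have h₁ : 2 ^ 6 ≤ (n + 2) ^ 6 := Nat.pow_le_pow_left (by omega) 6
    have h₂ : (n + 2) ^ 8 = (n + 2) ^ 6 * (n + 2) ^ 2 := by ring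
    rw [h₂, base_eq]
    nlinarith [Nat.mul_le_mul_right ((n + 2) ^ 2) h₁]
  obtain ⟨F, hok, hex, hlist⟩ := run_phases hL
  have hout : (phases.foldl (fun σ ph => ph.run L σ) (Data.init n)).out.length ≤ n * n := by
    simpa using (List.Nodup.of_map _ hlist.1).length_le_card
  obtain ⟨t, s, he, ht, h0, h1⟩ := Runs.seq (Runs.prologue (W := (n + 2) ^ 8) hlen (by omega))
    fun s hs => Runs.seq (Runs.phases phases hs hlen (by
      have : phases.length = 8 := rfl
      simp only [Data.init, List.length_nil, this]
      omega)) fun s' hs' => Runs.epilogue hs' (by omega)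
  refine ⟨t, s, he, ?_, ?_, ?_⟩
  · rw [hcard, add_mul]
    omega
  · simp only [isSquareRootGirthSeven_iff]
    intro h
    refine ⟨by rw [h0, hok.2 (hex h)]; rfl, F, _, hex h, hlist, h1⟩
  · simp only [isSquareRootGirthSeven_iff]
    intro h
    rw [h0, Bool.toNat_eq_zero, ← Bool.not_eq_true, hok]
    exact fun hF => h ⟨F, hF⟩
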